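/- Let $M$ be a smooth (Hausdorff) $3$-manifold with a contact sub-Lorentzian structure $(H,g)$: $H\subset TM$ is a contact distribution (of rank $2$) and $g$ is a smooth metric of signature $(-,+)$ on $H$. Suppose that $(H,g)$ is time and space oriented, i.e. a continuous timelike horizontal vector field $T$ and a continuous horizontal vector field $S$ with $g(S,S)>0$ are given. Let $\omega$ be the contact form with $\ker\omega=H$, normalized by $d\omega(e_1,e_2)=1$ for every basis $e_1,e_2$ of $H_q$, $q\in M$, with $g(e_1,e_1)=-1$, $g(e_1,e_2)=0$, $g(e_2,e_2)=1$, $g(e_1,T)<0$, $g(e_2,S)>0$, where $d\omega(X,Y)=X(\omega(Y))-Y(\omega(X))-\omega([X,Y])$. The Reeb vector field $X_0$ is defined by $\omega(X_0)=1$, $d\omega(X_0,\cdot)=0$. Let ${}^\sharp:H_q^*\to H_q$ be the isomorphism given by $g$, let $G:T^*M\to H$, $G(\lambda)=(\lambda|_H)^\sharp$, and let $h(\lambda)=\frac12\langle\lambda,G\lambda\rangle$ and $h_0(\lambda)=\langle\lambda,X_0\rangle$ for $\lambda\in T^*M$. The Poisson bracket $\{h,h_0\}$ (with the sign convention $\{h_X,h_Y\}=h_{[X,Y]}$,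 where $h_X(\lambda)=\langle\lambda,X\rangle$) is a quadratic form on each $T_q^*M$; the associated symmetric bilinear form $\{h,h_0\}_q$ descends to $T^*_qM/H_q^\perp$, where $H_q^\perp$ is the annihilator of $H_q$, and $G$ induces an isomorphism $F_q:T^*_qM/H_q^\perp\to H_q$. Put $\bar h_q(v,w)=\{h,h_0\}_q(F_q^{-1}v,F_q^{-1}w)$ and $\tilde h_q(v)=(\bar h_q(v,\cdot))^\sharp$ for $v,w\in H_q$; thus $\tilde h$ is a $(1,1)$-tensor on $H$. A vector field $Z$ on $M$ is an infinitesimal isometry of $(H,g)$ if its (local) flow $\psi^t$ consists of isometries, i.e. wherever $\psi^t$ is defined on an open set $U$, it is a diffeomorphism of $U$ onto an open subset of $M$ with $d\psi^t(H_q)\subset H_{\psi^t(q)}$ and $g(d\psi^t v,d\psi^t w)=g(v,w)$ for all $q\in U$ and $v,w\in H_q$. Then the Reeb vector field $X_0$ is an infinitesimal isometry of $(H,g)$ if and only if $\tilde h_q=0$ for every $q\in M$. -/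

import Mathlib

open scoped Manifold ContDiff Topology Bundle

noncomputable section

namespace SubLorentz

/-- The model space of 3-manifolds. -/
abbrev E3 : Type := EuclideanSpace ℝ (Fin 3)

section Calculus

variable {M : Type*} [TopologicalSpace M] [ChartedSpace E3 M]

/-- Fields of tangent vectors (no regularity). -/
abbrev VField (M : Type*) [TopologicalSpace M] [ChartedSpace E3 M] : Type _ :=
  ∀ q : M, TangentSpace (𝓡 3) q

/-- The cotangent space at `q`. -/
abbrev Cotangent (q : M) : Type _ := TangentSpace (𝓡 3) q →L[ℝ] ℝ

/-- Fields of covectors (no regularity). -/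
abbrev OneForm (M : Type*) [TopologicalSpace M] [ChartedSpace E3 M] : Type _ :=
  ∀ q : M, Cotangent q

/-- `X` is smooth on `U`, as a section of the tangent bundle. -/
def VField.SmoothOn [IsManifold (𝓡 3) ∞ M] (X : VField M) (U : Set M) : Prop :=
  ContMDiffOn (𝓡 3) (𝓡 3).tangent ∞ (fun q => (⟨q, X q⟩ : TangentBundle (𝓡 3) M)) U

/-- A covector at `φ⁻¹ x` read in the coordinates of the chart `φ` around `q`, i.e. the
momentum `p` with `λ = ∑ pᵢ dxᵢ`. -/
def toCoord (q : M) (x : E3) (lam : Cotangent ((extChartAt (𝓡 3) q).symm x)) : E3 →L[ℝ] ℝ :=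
  lam.comp (mfderiv 𝓘(ℝ, E3) (𝓡 3) (extChartAt (𝓡 3) q).symm x)

/-- The covector at `φ⁻¹ x` with momentum `p` in the coordinates of the chart `φ` around `q`. -/
def ofCoord (q : M) (x : E3) (p : E3 →L[ℝ] ℝ) : Cotangent ((extChartAt (𝓡 3) q).symm x) :=
  p.comp (mfderiv (𝓡 3) 𝓘(ℝ, E3) (extChartAt (𝓡 3) q) ((extChartAt (𝓡 3) q).symm x))

/-- The coordinate expression of the 1-form `α` in the chart around `q`. -/
def OneForm.inChart (α : OneForm M) (q : M) (x : E3) : E3 →L[ℝ] ℝ :=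
  toCoord q x (α ((extChartAt (𝓡 3) q).symm x))

/-- `α` is smooth on `U`: its coefficients are smooth in every preferred chart. -/
def OneForm.SmoothOn (α : OneForm M) (U : Set M) : Prop :=
  ∀ q : M, ContDiffOn ℝ ∞ (α.inChart q)
    ((extChartAt (𝓡 3) q).target ∩ (extChartAt (𝓡 3) q).symm ⁻¹' U)

/-- The exterior derivative of a 1-form, with the convention
`dα(X, Y) = X(α(Y)) - Y(α(X)) - α([X, Y])`, computed in the chart around `q`. -/
def OneForm.d (α : OneForm M) (q : M) (u v : TangentSpace (𝓡 3) q) : ℝ :=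
  let x := extChartAt (𝓡 3) q q
  let A := mfderiv (𝓡 3) 𝓘(ℝ, E3) (extChartAt (𝓡 3) q) q
  fderiv ℝ (α.inChart q) x (A u) (A v) - fderiv ℝ (α.inChart q) x (A v) (A u)

/-- The expression of a function on the cotangent bundle in the canonical coordinates `(x, p)`
induced by the chart around `q`. -/
def cotCoord (f : ∀ q : M, Cotangent q → ℝ) (q : M) (x : E3) (p : E3 →L[ℝ] ℝ) : ℝ :=
  f ((extChartAt (𝓡 3) q).symm x) (ofCoord q x p)

/-- The canonical Poisson bracket
`{f, k} = ∑ᵢ (∂f/∂pᵢ) (∂k/∂xᵢ) - (∂k/∂pᵢ) (∂f/∂xᵢ)` on the fibre over `q`, as a function of the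
momentum `p` in the canonical coordinates of the chart around `q`. (The partial differential
in `x` is an element of the dual of `E3`, to which the partial differential in `p` applies.) The
sign is such that `{h_X, h_Y} = h_{[X, Y]}` for `h_X(λ) = ⟨λ, X⟩`. -/
def poissonBracket (f k : ∀ q : M, Cotangent q → ℝ) (q : M) (p : E3 →L[ℝ] ℝ) : ℝ :=
  let x := extChartAt (𝓡 3) q q
  fderiv ℝ (fun p' => cotCoord f q x p') p (fderiv ℝ (fun x' => cotCoord k q x' p) x)
    - fderiv ℝ (fun p' => cotCoord k q x p') p (fderiv ℝ (fun x' => cotCoord f q x' p) x)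

/-- The momentum, in the chart around `q`, of a covector at the point `q` itself. -/
def momentum (q : M) : Cotangent q →ₗ[ℝ] (E3 →L[ℝ] ℝ) where
  toFun lam := lam.comp
    (mfderiv (𝓡 3) 𝓘(ℝ, E3) (extChartAt (𝓡 3) q) q).inverse
  map_add' a b := by ext; rfl
  map_smul' c a := by ext; rfl

/-- The symmetric bilinear form `B = D²Q(0) / 2` associated with a quadratic form `Q` on a normed
space, so that `Q w = B w w`. -/
def polarization {W : Type*} [NormedAddCommGroup W] [NormedSpace ℝ W] (Q : W → ℝ) :
    LinearMap.BilinForm ℝ W :=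
  LinearMap.mk₂ ℝ (fun a b => (1 / 2) * fderiv ℝ (fderiv ℝ Q) 0 a b)
    (fun a b c => by simp [mul_add]) (fun r a b => by simp; ring)
    (fun a b c => by simp [mul_add]) (fun r a b => by simp; ring)

end Calculus

/-- A contact sub-Lorentzian structure `(H, g)` on a 3-manifold. A contact distribution is locally
the kernel of a smooth nowhere zero 1-form whose exterior derivative is nondegenerate on it; in
particular it is smooth, of rank 2 and bracket generating. -/
structure ContactStructure (M : Type*) [TopologicalSpace M] [ChartedSpace E3 M]
    [IsManifold (𝓡 3) ∞ M] where
  /-- the distribution -/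
  H : ∀ q : M, Submodule ℝ (TangentSpace (𝓡 3) q)
  contact : ∀ q : M, ∃ U : Set M, IsOpen U ∧ q ∈ U ∧ ∃ α : OneForm M, α.SmoothOn U ∧
    ∀ p ∈ U, α p ≠ 0 ∧ (∀ v, v ∈ H p ↔ α p v = 0) ∧
      ∀ u ∈ H p, u ≠ 0 → ∃ v ∈ H p, α.d p u v ≠ 0
  /-- the metric on the distribution -/
  g : ∀ q : M, LinearMap.BilinForm ℝ (H q)
  g_symm : ∀ q (v w : H q), g q v w = g q w v
  /-- the metric has signature `(-, +)` -/
  g_lorentz : ∀ q, ∃ b : Module.Basis (Fin 2) ℝ (H q),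
    g q (b 0) (b 0) = -1 ∧ g q (b 0) (b 1) = 0 ∧ g q (b 1) (b 1) = 1
  /-- the metric is smooth: `g(X, Y)` is smooth for all local smooth horizontal fields -/
  g_smooth : ∀ (U : Set M), IsOpen U → ∀ X Y : (∀ q, H q),
    VField.SmoothOn (fun q => (X q : TangentSpace (𝓡 3) q)) U →
    VField.SmoothOn (fun q => (Y q : TangentSpace (𝓡 3) q)) U →
    ContMDiffOn (𝓡 3) 𝓘(ℝ, ℝ) ∞ (fun q => g q (X q) (Y q)) U

variable {M : Type*} [TopologicalSpace M] [ChartedSpace E3 M] [IsManifold (𝓡 3) ∞ M]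

/-- A time orientation and a space orientation of a rank 2 structure, given by a continuous
timelike and a continuous spacelike (nowhere zero) horizontal vector field. -/
structure TSOrientation (L : ContactStructure M) where
  timeField : ∀ q : M, L.H q
  spaceField : ∀ q : M, L.H q
  time_cont : Continuous
    (fun q => (⟨q, (timeField q : TangentSpace (𝓡 3) q)⟩ : TangentBundle (𝓡 3) M))
  space_cont : Continuous
    (fun q => (⟨q, (spaceField q : TangentSpace (𝓡 3) q)⟩ : TangentBundle (𝓡 3) M))
  timelike : ∀ q, L.g q (timeField q) (timeField q) < 0
  spacelike : ∀ q, 0 < L.g q (spaceField q) (spaceField q)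

/-- `(e₁, e₂)` is an orthonormal basis of `H q`, with `e₁` timelike and `e₂` spacelike, that agrees
with the time and the space orientation. -/
def TSOrientation.IsOrientedFrame {L : ContactStructure M} (o : TSOrientation L) (q : M)
    (e₁ e₂ : L.H q) : Prop :=
  L.g q e₁ e₁ = -1 ∧ L.g q e₁ e₂ = 0 ∧ L.g q e₂ e₂ = 1 ∧
    L.g q e₁ (o.timeField q) < 0 ∧ 0 < L.g q e₂ (o.spaceField q)

/-- `α` is the normalized contact form: smooth, `H = ker α`, and `dα(e₁, e₂) = 1` for the
oriented orthonormal bases of `H`. -/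
def TSOrientation.IsNormalizedContactForm {L : ContactStructure M} (o : TSOrientation L)
    (α : OneForm M) : Prop :=
  α.SmoothOn Set.univ ∧ (∀ q v, v ∈ L.H q ↔ α q v = 0) ∧
    ∀ q (e₁ e₂ : L.H q), o.IsOrientedFrame q e₁ e₂ → α.d q e₁ e₂ = 1

/-- `X₀` is the Reeb vector field: `α(X₀) = 1` and `dα(X₀, ·) = 0`, for the normalized contact
form `α`. -/
def TSOrientation.IsReebField {L : ContactStructure M} (o : TSOrientation L)
    (X₀ : VField M) : Prop :=
  X₀.SmoothOn Set.univ ∧ ∃ α : OneForm M, o.IsNormalizedContactForm α ∧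
    (∀ q, α q (X₀ q) = 1) ∧ ∀ q v, α.d q (X₀ q) v = 0

namespace ContactStructure

variable (L : ContactStructure M)

/-! ### Infinitesimal isometries -/

/-- `f` restricts to a sub-Lorentzian isometry of the open set `U` onto its image: it is a
diffeomorphism of `U` onto an open set, and its differential maps `H` into `H` and preserves `g`. -/
def IsIsometryOn (U : Set M) (f : M → M) : Prop :=
  (∃ Φ : PartialDiffeomorph (𝓡 3) (𝓡 3) M M ∞, Φ.source = U ∧ Set.EqOn f Φ U) ∧
    ∀ p ∈ U, ∃ hH : ∀ v ∈ L.H p, mfderiv (𝓡 3) (𝓡 3) f p v ∈ L.H (f p),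
      ∀ v w : L.H p,
        L.g (f p) ⟨mfderiv (𝓡 3) (𝓡 3) f p v, hH v v.2⟩ ⟨mfderiv (𝓡 3) (𝓡 3) f p w, hH w w.2⟩
          = L.g p v w

end ContactStructure

/-- `ψ` is a local flow of `Z`, defined for times in the open interval `J ∋ 0` and initial
points in the open set `U`. -/
structure IsLocalFlow (Z : VField M) (J : Set ℝ) (U : Set M) (ψ : ℝ → M → M) : Prop where
  open_J : IsOpen J
  interval_J : J.OrdConnected
  zero_mem : (0 : ℝ) ∈ J
  open_U : IsOpen U
  smooth : ContMDiffOn (𝓘(ℝ, ℝ).prod (𝓡 3)) (𝓡 3) ∞ (fun z : ℝ × M => ψ z.1 z.2) (J ×ˢ U)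
  initial : ∀ p ∈ U, ψ 0 p = p
  integral : ∀ p ∈ U, IsMIntegralCurveOn (fun t => ψ t p) Z J

/-- `Z` is an infinitesimal isometry: its (local) flow consists of isometries. -/
def ContactStructure.IsInfinitesimalIsometry (L : ContactStructure M) (Z : VField M) : Prop :=
  ∀ (J : Set ℝ) (U : Set M) (ψ : ℝ → M → M), IsLocalFlow Z J U ψ →
    ∀ t ∈ J, L.IsIsometryOn U (ψ t)

namespace ContactStructure

variable (L : ContactStructure M)

/-! ### The geodesic Hamiltonian and the invariant tensor -/

instance (q : M) : FiniteDimensional ℝ (TangentSpace (𝓡 3) q) :=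
  inferInstanceAs (FiniteDimensional ℝ E3)

theorem g_nondegenerate (q : M) : (L.g q).Nondegenerate := by
  obtain ⟨b, h00, h01, h11⟩ := L.g_lorentz q
  have h10 : L.g q (b 1) (b 0) = 0 := by rw [L.g_symm]; exact h01
  have key : ∀ v : L.H q, (∀ w, L.g q v w = 0) → v = 0 := by
    intro v hv
    have e := b.sum_repr v
    rw [Fin.sum_univ_two] at e
    have h0 := hv (b 0)
    have h1 := hv (b 1)
    rw [← e] at h0 h1
    simp only [map_add, map_smul, LinearMap.add_apply, LinearMap.smul_apply, smul_eq_mul,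
      h00, h01, h10, h11] at h0 h1
    have a0 : b.repr v 0 = 0 := by linarith
    have a1 : b.repr v 1 = 0 := by linarith
    rw [← e, a0, a1]; simp
  exact ⟨key, fun v hv => key v fun w => by rw [L.g_symm]; exact hv w⟩

/-- The musical isomorphism `♯` from the dual of `H q` to `H q`:
`g (β♯, w) = β w` for all `w` in `H q`. -/
def sharp (q : M) : Module.Dual ℝ (L.H q) ≃ₗ[ℝ] L.H q :=
  (LinearMap.BilinForm.toDual (L.g q) (L.g_nondegenerate q)).symm

/-- The bundle map `G : T*M → H`, `G λ = (λ|H)♯`. -/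
def G (q : M) : Cotangent q →ₗ[ℝ] L.H q where
  toFun lam := L.sharp q ((lam : TangentSpace (𝓡 3) q →ₗ[ℝ] ℝ).domRestrict (L.H q))
  map_add' a b := by rw [← map_add]; rfl
  map_smul' c a := by rw [RingHom.id_apply, ← map_smul]; rfl

/-- The geodesic Hamiltonian `h(λ) = ⟨λ, G λ⟩ / 2`. -/
def geodesicHamiltonian (q : M) (lam : Cotangent q) : ℝ :=
  (1 / 2) * lam (L.G q lam)

/-- The symmetric bilinear form `{h, h₀}_q` on `T*_q M` associated with the quadratic form
`λ ↦ {h, h₀}(λ)` on `T*_q M`, where `h₀(λ) = ⟨λ, X₀⟩`. -/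
def bracketForm (X₀ : VField M) (q : M) : LinearMap.BilinForm ℝ (Cotangent q) :=
  (polarization (poissonBracket L.geodesicHamiltonian (fun q' lam => lam (X₀ q')) q)).compl₁₂
    (momentum q) (momentum q)

theorem G_surjective (q : M) : Function.Surjective (L.G q) := by
  intro v
  obtain ⟨l, hl⟩ := LinearMap.exists_extend ((L.sharp q).symm v)
  have : T2Space (TangentSpace (𝓡 3) q) := inferInstanceAs (T2Space E3)
  refine ⟨LinearMap.toContinuousLinearMap l, ?_⟩
  have hr : ((LinearMap.toContinuousLinearMap l : TangentSpace (𝓡 3) q →L[ℝ] ℝ) :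
      TangentSpace (𝓡 3) q →ₗ[ℝ] ℝ).domRestrict (L.H q) = (L.sharp q).symm v := hl
  change L.sharp q _ = v
  rw [hr]
  exact (L.sharp q).apply_symm_apply v

/-- A linear choice of representatives for the inverse of the isomorphism
`F : T*_q M / H_q^⊥ → H_q`, `F [λ] = G λ`. -/
def liftG (q : M) : L.H q →ₗ[ℝ] Cotangent q :=
  Classical.choose ((L.G q).exists_rightInverse_of_surjective
    (LinearMap.range_eq_top.mpr (L.G_surjective q)))

theorem G_liftG (q : M) (v : L.H q) : L.G q (L.liftG q v) = v :=
  LinearMap.congr_fun (Classical.choose_spec ((L.G q).exists_rightInverse_of_surjective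
    (LinearMap.range_eq_top.mpr (L.G_surjective q)))) v

/-- The symmetric bilinear form `h̄ (v, w) = {h, h₀} (F⁻¹ v, F⁻¹ w)` on `H q`. When `X₀` is the Reeb
field, `H_q^⊥` lies in the kernel of the bracket form, so the choice of representatives is
immaterial. -/
def hBar (X₀ : VField M) (q : M) : LinearMap.BilinForm ℝ (L.H q) :=
  (L.bracketForm X₀ q).compl₁₂ (L.liftG q) (L.liftG q)

/-- The invariant (1,1)-tensor `h̃ v = (h̄ (v, ·))♯` on `H`. -/
def hTilde (X₀ : VField M) (q : M) : L.H q →ₗ[ℝ] L.H q :=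
  (L.sharp q).toLinearMap ∘ₗ L.hBar X₀ q

end ContactStructure

end SubLorentz

end

/-! Extend `g` to a metric `γ` on the whole tangent bundle by making `X₀` a unit normal to `H`:
`γ(u, v) = g(πu, πv) + α(u)α(v)`, with `π` the projection on `H` along `X₀`. The inverse of `γ` is
`G + X₀ ⊗ X₀`, so `h` is half of the quadratic form of `γ⁻¹` minus half of `h₀²`. Since `h₀²`
commutes with `h₀`, the bracket `{h, h₀}` is `½ (L_{X₀} γ)` evaluated on `γ⁻¹p`
(`bracket_eq_lieBilin`).

The conditions `α(X₀) = 1` and `dα(X₀, ·) = 0` give `L_{X₀} α = 0`. As `γ(X₀, ·) = α`, also `(L_{X₀}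
γ)(X₀, ·) = 0` (`lieAt_metric_field`). Hence `h̄` is `½ L_{X₀} γ` restricted to `H` (`hBar_eq`), and
`h̃ = 0` is equivalent to `L_{X₀} γ = 0`.

The derivative in time of the pull back of a bilinear form along the flow is the pull back of its
Lie derivative (`IsLocalFlow.hasDerivAt_pullback`). If `L_{X₀} γ = 0`, the flow preserves `γ` and `α
⊗ α`, hence `H` and `g`; its time maps are injective local diffeomorphisms, so diffeomorphisms onto
open images. Conversely, if every local flow consists of isometries, differentiating the constant
pull back at time `0` gives `L_{X₀} γ = 0` on `H`. This direction needs a smooth local flow near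
each point, obtained from the implicit function theorem in a Banach space of curves
(`exists_smooth_flow`). -/

noncomputable section

namespace SubLorentz

/-! ### Smoothness of composition operators on spaces of continuous maps -/

section Nemytskii

universe u

variable {K : Type*} [TopologicalSpace K] [CompactSpace K]
variable {E F : Type u} [NormedAddCommGroup E] [NormedSpace ℝ E]
  [NormedAddCommGroup F] [NormedSpace ℝ F]

/-- The pointwise extension of a bilinear operation to continuous maps. -/
def pointwiseL (K : Type*) [TopologicalSpace K] [CompactSpace K] {A E F : Type*}
    [NormedAddCommGroup A] [NormedSpace ℝ A] [NormedAddCommGroup E] [NormedSpace ℝ E]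
    [NormedAddCommGroup F] [NormedSpace ℝ F] (B : A →L[ℝ] E →L[ℝ] F) :
    C(K, A) →L[ℝ] C(K, E) →L[ℝ] C(K, F) :=
  LinearMap.mkContinuous₂
    (LinearMap.mk₂ ℝ (fun (a : C(K, A)) (h : C(K, E)) =>
      (⟨fun t => B (a t) (h t), by fun_prop⟩ : C(K, F)))
      (fun _ _ _ => by ext; simp) (fun _ _ _ => by ext; simp)
      (fun _ _ _ => by ext; simp) (fun _ _ _ => by ext; simp)) ‖B‖
    (fun a h => by
      rw [ContinuousMap.norm_le _ (by positivity)]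
      intro t
      refine (B.le_opNorm₂ _ _).trans ?_
      gcongr
      · exact a.norm_coe_le_norm t
      · exact h.norm_coe_le_norm t)

/-- The composition operator `v ↦ f ∘ v` on continuous maps. -/
def nemytskii (K : Type*) [TopologicalSpace K] (f : C(E, F)) (v : C(K, E)) : C(K, F) := f.comp v

/-- The mean value inequality is applied at each `t`. The bound is uniform in `t` because `v ↦ f' ∘
v` is continuous for the sup norm; this replaces uniform continuity of `f'`, which is not available
on all of `E`. -/
theorem hasFDerivAt_nemytskii {f : C(E, F)} {f' : C(E, E →L[ℝ] F)}
    (hf : ∀ x, HasFDerivAt f (f' x) x) (v : C(K, E)) :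
    HasFDerivAt (nemytskii K f)
      (pointwiseL K (ContinuousLinearMap.id ℝ (E →L[ℝ] F)) (nemytskii K f' v)) v := by
  rw [hasFDerivAt_iff_isLittleO_nhds_zero, Asymptotics.isLittleO_iff]
  intro c hc
  have hcont : Continuous (nemytskii K f') := ContinuousMap.continuous_postcomp f'
  obtain ⟨δ, hδ, hδ'⟩ := Metric.continuous_iff.1 hcont v c hc
  filter_upwards [Metric.ball_mem_nhds (0 : C(K, E)) hδ] with h hh
  rw [ContinuousMap.norm_le _ (by positivity)]
  intro t
  have hnorm : ‖h‖ < δ := by simpa using hh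
  -- Each point of the segment is the value at `t` of a curve `v + s • h`, which lies in the
  -- `δ`-ball around `v`.
  have key : ∀ y ∈ segment ℝ (v t) (v t + h t), ‖f' y - f' (v t)‖ ≤ c := by
    intro y hy
    rw [segment_eq_image'] at hy
    obtain ⟨s, ⟨hs0, hs1⟩, rfl⟩ := hy
    have h1 : dist (v + s • h) v < δ := by
      rw [dist_eq_norm, add_sub_cancel_left, norm_smul, Real.norm_of_nonneg hs0]
      nlinarith [norm_nonneg h]
    have h2 := (ContinuousMap.dist_apply_le_dist t).trans (hδ' _ h1).le
    simpa [nemytskii, dist_eq_norm] using h2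
  have := (convex_segment (𝕜 := ℝ) (v t) (v t + h t)).norm_image_sub_le_of_norm_hasFDerivWithin_le'
    (fun y _ => (hf y).hasFDerivWithinAt) key (left_mem_segment ℝ _ _) (right_mem_segment ℝ _ _)
  simp only [add_sub_cancel_left] at this
  exact this.trans (mul_le_mul_of_nonneg_left (h.norm_coe_le_norm t) hc.le)

/-- The derivative is again a composition operator, for `f'`, followed by a continuous linear map.
The codomain changes to `E →L[ℝ] F`, so the induction runs over all `F`, and `E` and `F` share a
universe. -/
theorem contDiff_nat_nemytskii (n : ℕ) : ∀ {F : Type u} [NormedAddCommGroup F] [NormedSpace ℝ F]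
    (f : C(E, F)), ContDiff ℝ n f → ContDiff ℝ n (nemytskii K f) := by
  induction n with
  | zero =>
    intro F _ _ f _
    exact contDiff_zero.2 (ContinuousMap.continuous_postcomp f)
  | succ n ih =>
    intro F _ _ f hf
    obtain ⟨hd, -, hn⟩ := (contDiff_succ_iff_fderiv (n := n)).1 (by exact_mod_cast hf)
    let f' : C(E, E →L[ℝ] F) := ⟨fderiv ℝ f, hn.continuous⟩
    have := contDiff_succ_iff_hasFDerivAt (𝕜 := ℝ) (n := n) (f := nemytskii K f)
    exact_mod_cast this.2
      ⟨fun v => pointwiseL K (ContinuousLinearMap.id ℝ (E →L[ℝ] F)) (nemytskii K f' v),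
      (pointwiseL K (ContinuousLinearMap.id ℝ (E →L[ℝ] F))).contDiff.comp (ih f' hn),
      fun v => hasFDerivAt_nemytskii (f' := f') (fun x => (hd x).hasFDerivAt) v⟩

theorem contDiff_nemytskii {f : C(E, F)} (hf : ContDiff ℝ ∞ f) : ContDiff ℝ ∞ (nemytskii K f) :=
  contDiff_infty.2 fun n => contDiff_nat_nemytskii n f (contDiff_infty.1 hf n)

end Nemytskii

/-! ### Smooth local flows in a Banach space -/

section Flow

variable {E : Type*} [NormedAddCommGroup E] [NormedSpace ℝ E] [CompleteSpace E]

/-- The rescaled time interval. -/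
abbrev Time : Type := Set.Icc (-1 : ℝ) 1

/-- The retraction of the line on the time interval. -/
abbrev toTime (s : ℝ) : Time := Set.projIcc (-1 : ℝ) 1 (by norm_num) s

/-- The primitive that vanishes at `0`. -/
def primitive (E : Type*) [NormedAddCommGroup E] [NormedSpace ℝ E] [CompleteSpace E] :
    C(Time, E) →L[ℝ] C(Time, E) :=
  LinearMap.mkContinuous
    { toFun := fun v => ⟨fun s => ∫ τ in (0 : ℝ)..s, v (toTime τ), by
        have : Continuous fun s : ℝ => ∫ τ in (0 : ℝ)..s, v (toTime τ) :=
          intervalIntegral.continuous_primitive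
            (fun _ _ => (v.continuous.comp continuous_projIcc).intervalIntegrable _ _) _
        exact this.comp continuous_subtype_val⟩
      map_add' := fun v w => by
        ext s
        exact intervalIntegral.integral_add
          ((v.continuous.comp continuous_projIcc).intervalIntegrable _ _)
          ((w.continuous.comp continuous_projIcc).intervalIntegrable _ _)
      map_smul' := fun c v => by
        ext s
        exact intervalIntegral.integral_smul _ _ } 1
    (fun v => by
      rw [one_mul, ContinuousMap.norm_le _ (norm_nonneg _)]
      intro s
      refine (intervalIntegral.norm_integral_le_of_norm_le_const
        (fun τ _ => v.norm_coe_le_norm (toTime τ))).trans ?_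
      have : |(s : ℝ) - 0| ≤ 1 := by rw [sub_zero]; exact abs_le.2 s.2
      exact mul_le_of_le_one_right (norm_nonneg _) this)

theorem norm_primitive_le (v : C(Time, E)) : ‖primitive E v‖ ≤ ‖v‖ := by
  have := (primitive E).le_of_opNorm_le (LinearMap.mkContinuous_norm_le _ zero_le_one _) v
  simpa using this

/-- Constant curves. -/
def constL (E : Type*) [NormedAddCommGroup E] [NormedSpace ℝ E] : E →L[ℝ] C(Time, E) :=
  LinearMap.mkContinuous
    { toFun := fun x => ContinuousMap.const _ x
      map_add' := fun _ _ => rfl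
      map_smul' := fun _ _ => rfl } 1
    (fun x => by
      rw [one_mul, ContinuousMap.norm_le _ (norm_nonneg _)]
      intro s
      exact le_rfl)

@[simp]
theorem constL_apply {E : Type*} [NormedAddCommGroup E] [NormedSpace ℝ E] (x : E)
    (s : Time) : constL E x s = x := rfl

/-- The defect of the integral equation `v s = x + t ∫₀ˢ f (v τ) dτ`. -/
def defect (f : C(E, E)) (z : (ℝ × E) × C(Time, E)) : C(Time, E) :=
  z.2 - constL E z.1.2 - z.1.1 • primitive E (nemytskii Time f z.2)

theorem contDiff_defect {f : C(E, E)} (hf : ContDiff ℝ ∞ f) : ContDiff ℝ ∞ (defect f) := by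
  have h1 : ContDiff ℝ ∞ (fun z : (ℝ × E) × C(Time, E) => nemytskii Time f z.2) :=
    (contDiff_nemytskii hf).comp contDiff_snd
  unfold defect
  fun_prop

/-- The integral operator is a contraction with constant `|t| * k`. -/
theorem defect_injective {f : C(E, E)} {k : NNReal} (hf : LipschitzWith k f) {t : ℝ} {x : E}
    (ht : |t| * k < 1) {v w : C(Time, E)} (hv : defect f ((t, x), v) = 0)
    (hw : defect f ((t, x), w) = 0) : v = w := by
  have h1 : v - w = t • primitive E (nemytskii Time f v - nemytskii Time f w) := by
    have : defect f ((t, x), v) - defect f ((t, x), w) = 0 := by rw [hv, hw, sub_zero]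
    rw [map_sub, smul_sub]
    simp only [defect] at this
    rw [← sub_eq_zero, ← this]
    abel
  have h2 : ‖nemytskii Time f v - nemytskii Time f w‖ ≤ k * ‖v - w‖ := by
    rw [ContinuousMap.norm_le _ (by positivity)]
    intro s
    have := hf.dist_le_mul (v s) (w s)
    rw [dist_eq_norm, dist_eq_norm] at this
    exact this.trans (mul_le_mul_of_nonneg_left ((v - w).norm_coe_le_norm s) k.2)
  have h3 : ‖v - w‖ ≤ |t| * (k * ‖v - w‖) := by
    conv_lhs => rw [h1, norm_smul, Real.norm_eq_abs]
    exact mul_le_mul_of_nonneg_left ((norm_primitive_le _).trans h2) (abs_nonneg t)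
  have h4 : ‖v - w‖ ≤ 0 := by
    by_contra! h
    nlinarith
  exact sub_eq_zero.1 (norm_le_zero_iff.1 h4)

/-- Smooth dependence of the solution of the rescaled integral equation on the parameters. -/
theorem exists_solution_map {f : C(E, E)} (hf : ContDiff ℝ ∞ f) (x₀ : E) :
    ∃ N : Set (ℝ × E), IsOpen N ∧ (0, x₀) ∈ N ∧ ∃ v : ℝ × E → C(Time, E),
      ContDiffOn ℝ ∞ v N ∧ ∀ z ∈ N, defect f (z, v z) = 0 := by
  -- The implicit function is read off from the local inverse of `Ψ`, as the second component of the
  -- preimage of `(z, 0)`.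
  let Ψ : (ℝ × E) × C(Time, E) → (ℝ × E) × C(Time, E) := fun z => (z.1, defect f z)
  have hΨ : ContDiff ℝ ∞ Ψ := contDiff_fst.prodMk (contDiff_defect hf)
  let a : (ℝ × E) × C(Time, E) := ((0, x₀), constL E x₀)
  have hΨa : Ψ a = ((0, x₀), 0) := by simp [Ψ, a, defect]
  -- the derivative at `a` is a shear
  obtain ⟨e', he'⟩ : ∃ e' : ((ℝ × E) × C(Time, E)) ≃L[ℝ] ((ℝ × E) × C(Time, E)),
      HasFDerivAt Ψ (e' : ((ℝ × E) × C(Time, E)) →L[ℝ] ((ℝ × E) × C(Time, E))) a := by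
    let D := fderiv ℝ (defect f) a
    have hD : HasFDerivAt (defect f) D a :=
      ((contDiff_defect hf).differentiable (by simp) a).hasFDerivAt
    -- At `t = 0` the integral term drops out, so the partial differential in the curve is the
    -- identity.
    have hinr : ∀ w : C(Time, E), D (0, w) = w := by
      have h1 : HasFDerivAt (fun w : C(Time, E) => defect f ((0, x₀), w))
          (D.comp (ContinuousLinearMap.inr ℝ (ℝ × E) C(Time, E))) (constL E x₀) :=
        HasFDerivAt.comp (constL E x₀) (f := fun w : C(Time, E) => ((0, x₀), w)) hD
          (hasFDerivAt_prodMk_right _ _)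
      have h2 : HasFDerivAt (fun w : C(Time, E) => defect f ((0, x₀), w))
          (ContinuousLinearMap.id ℝ C(Time, E)) (constL E x₀) := by
        simp only [defect, zero_smul, sub_zero]
        exact (hasFDerivAt_id _).sub_const _
      intro w
      simpa using DFunLike.congr_fun (h1.unique h2) w
    have hsplit : ∀ z : (ℝ × E) × C(Time, E), D z = D (z.1, 0) + z.2 := by
      intro z
      conv_rhs => rw [← hinr z.2]
      rw [← map_add]
      simp
    let S := (ContinuousLinearMap.fst ℝ (ℝ × E) C(Time, E)).prod D
    let T := (ContinuousLinearMap.fst ℝ (ℝ × E) C(Time, E)).prod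
      (ContinuousLinearMap.snd ℝ (ℝ × E) C(Time, E) -
        D.comp ((ContinuousLinearMap.inl ℝ (ℝ × E) C(Time, E)).comp
          (ContinuousLinearMap.fst ℝ (ℝ × E) C(Time, E))))
    refine ⟨ContinuousLinearEquiv.equivOfInverse S T (fun z => ?_) (fun z => ?_), ?_⟩
    · ext1
      · rfl
      · simp [S, T, hsplit z]
    · ext1
      · rfl
      · change D (z.1, z.2 - D (z.1, 0)) = z.2
        rw [hsplit]
        simp
    · exact hasFDerivAt_fst.prodMk hD
  let e := (hΨ.contDiffAt (x := a)).toOpenPartialHomeomorph Ψ he' (by simp)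
  have hea : a ∈ e.source := ContDiffAt.mem_toOpenPartialHomeomorph_source _ he' (by simp)
  have hcoe : ⇑e = Ψ := ContDiffAt.toOpenPartialHomeomorph_coe _ he' (by simp)
  -- Smoothness of the inverse on a neighbourhood needs an invertible derivative at nearby points
  -- too; the invertible operators form a neighbourhood of `e'`, which gives the open set `W`.
  let R : Set (((ℝ × E) × C(Time, E)) →L[ℝ] ((ℝ × E) × C(Time, E))) :=
    Set.range (fun D : ((ℝ × E) × C(Time, E)) ≃L[ℝ] ((ℝ × E) × C(Time, E)) => D)
  let W : Set ((ℝ × E) × C(Time, E)) := fderiv ℝ Ψ ⁻¹' interior R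
  have hW : IsOpen W := isOpen_interior.preimage (hΨ.continuous_fderiv (by simp))
  have haW : a ∈ W := by
    change fderiv ℝ Ψ a ∈ interior R
    rw [he'.fderiv, mem_interior_iff_mem_nhds]
    exact ContinuousLinearEquiv.nhds e'
  let O := e.target ∩ e.symm ⁻¹' W
  have hO : IsOpen O := e.isOpen_inter_preimage_symm hW
  have hsm : ContDiffOn ℝ ∞ e.symm O := by
    intro y hy
    obtain ⟨D, hD⟩ : fderiv ℝ Ψ (e.symm y) ∈ R := interior_subset hy.2
    refine (e.contDiffAt_symm (f₀' := D) hy.1 ?_ ?_).contDiffWithinAt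
    · rw [hcoe]
      simp only [hD]
      exact (hΨ.differentiable (by simp) _).hasFDerivAt
    · rw [hcoe]
      exact hΨ.contDiffAt
  have hι : ContDiff ℝ ∞ (fun z : ℝ × E => (z, (0 : C(Time, E)))) :=
    contDiff_id.prodMk contDiff_const
  refine ⟨(fun z : ℝ × E => (z, (0 : C(Time, E)))) ⁻¹' O, hO.preimage hι.continuous, ?_,
    fun z => (e.symm (z, 0)).2, ?_, ?_⟩
  · change ((0, x₀), (0 : C(Time, E))) ∈ O
    rw [← hΨa, ← hcoe]
    refine ⟨e.map_source hea, ?_⟩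
    rw [Set.mem_preimage, e.left_inv hea]
    exact haW
  · exact contDiff_snd.comp_contDiffOn (hsm.comp hι.contDiffOn (fun z hz => hz))
  · intro z hz
    have h1 := e.right_inv hz.1
    rw [hcoe] at h1
    have h2 : (e.symm (z, 0)).1 = z := congrArg Prod.fst h1
    have h3 : defect f (e.symm (z, 0)) = 0 := congrArg Prod.snd h1
    rw [show (z, (e.symm (z, 0)).2) = e.symm (z, 0) from Prod.ext h2.symm rfl]
    exact h3

/-- A smooth Lipschitz vector field has smooth local flows. -/
theorem exists_smooth_flow {f : E → E} (hf : ContDiff ℝ ∞ f) {k : NNReal} (hk : LipschitzWith k f)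
    (x₀ : E) : ∃ ε > 0, ∃ V : Set E, IsOpen V ∧ x₀ ∈ V ∧ ∃ ψ : ℝ × E → E,
      ContDiffOn ℝ ∞ ψ (Set.Ioo (-ε) ε ×ˢ V) ∧ (∀ x ∈ V, ψ (0, x) = x) ∧
      ∀ x ∈ V, ∀ t ∈ Set.Ioo (-ε) ε, HasDerivAt (fun s => ψ (s, x)) (f (ψ (t, x))) t := by
  let F : C(E, E) := ⟨f, hf.continuous⟩
  obtain ⟨N, hN, hN0, v, hv, hdef⟩ := exists_solution_map (f := F) hf x₀
  obtain ⟨A, hA, V, hV, hAV⟩ := mem_nhds_prod_iff.1 (hN.mem_nhds hN0)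
  obtain ⟨V', hV'V, hV', hx₀⟩ := mem_nhds_iff.1 hV
  obtain ⟨r, hr, hrA⟩ := Metric.mem_nhds_iff.1 hA
  -- `r` keeps `(t, x)` in `N`; `1 / (k + 1)` gives `|t| * k < 1`, also for `k = 0`.
  let ε := min r (1 / (k + 1))
  have hε : 0 < ε := by positivity
  have hmem : ∀ t, |t| < ε → ∀ x ∈ V', (t, x) ∈ N := fun t ht x hx => hAV
    ⟨hrA (by simpa using ht.trans_le (min_le_left _ _)), hV'V hx⟩
  have hsmall : ∀ t, |t| < ε → |t| * k < 1 := by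
    intro t ht
    have h1 := ht.trans_le (min_le_right _ _)
    rw [lt_div_iff₀ (by positivity)] at h1
    nlinarith [abs_nonneg t]
  have hsol : ∀ t, |t| < ε → ∀ x ∈ V', ∀ s : Time,
      v (t, x) s = x + t • ∫ τ in (0 : ℝ)..s, f (v (t, x) (toTime τ)) := by
    intro t ht x hx s
    have := DFunLike.congr_fun (hdef _ (hmem t ht x hx)) s
    simp only [defect, ContinuousMap.sub_apply, ContinuousMap.zero_apply, sub_sub, sub_eq_zero] at this
    exact this
  let one : Time := ⟨1, by norm_num⟩
  -- The curve `σ ↦ v (t, x) (s * σ)` solves the equation with parameter `t * s`, so uniqueness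
  -- identifies it with `v (t * s, x)`.
  have hscale : ∀ t, |t| < ε → ∀ x ∈ V', ∀ s : Time, v (t, x) s = v (t * s, x) one := by
    intro t ht x hx s
    have hs : |(s : ℝ)| ≤ 1 := abs_le.2 s.2
    have hts : |t * s| < ε := by
      rw [abs_mul]
      exact (mul_le_of_le_one_right (abs_nonneg t) hs).trans_lt ht
    let w : C(Time, E) := (v (t, x)).comp ⟨fun σ => toTime (s * σ), by fun_prop⟩
    have hproj : ∀ σ : Time, (toTime (s * σ) : ℝ) = s * σ := by
      intro σ
      have h1 : |(s * σ : ℝ)| ≤ 1 := by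
        rw [abs_mul]
        exact mul_le_one₀ hs (abs_nonneg _) (abs_le.2 σ.2)
      exact congrArg Subtype.val (Set.projIcc_of_mem _ (abs_le.1 h1))
    have hw : defect F ((t * s, x), w) = 0 := by
      ext σ
      have h1 : w σ = x + t • ∫ τ in (0 : ℝ)..(s * σ), f (v (t, x) (toTime τ)) := by
        rw [← hproj σ]
        exact hsol t ht x hx _
      have h2 : ∫ τ in (0 : ℝ)..σ, f (w (toTime τ)) =
          ∫ τ in (0 : ℝ)..σ, f (v (t, x) (toTime (s * τ))) := by
        refine intervalIntegral.integral_congr fun τ hτ => ?_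
        have hτ' : τ ∈ Set.Icc (-1 : ℝ) 1 :=
          Set.uIcc_subset_Icc (by norm_num) σ.2 hτ
        change f (v (t, x) (toTime (s * (toTime τ : ℝ)))) = _
        rw [show (toTime τ : ℝ) = τ from congrArg Subtype.val (Set.projIcc_of_mem _ hτ')]
      have h3 := intervalIntegral.smul_integral_comp_mul_left (a := 0) (b := (σ : ℝ))
        (fun τ => f (v (t, x) (toTime τ))) (s : ℝ)
      rw [mul_zero] at h3
      have h4 : primitive E (nemytskii Time F w) σ = ∫ τ in (0 : ℝ)..σ, f (w (toTime τ)) := rfl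
      simp only [defect, ContinuousMap.sub_apply, ContinuousMap.smul_apply, constL_apply,
        ContinuousMap.zero_apply]
      rw [h4, h2, h1, ← h3, mul_smul]
      abel
    have := defect_injective (f := F) hk (hsmall _ hts) hw (hdef _ (hmem _ hts x hx))
    rw [← this]
    change _ = v (t, x) (toTime (s * (1 : ℝ)))
    rw [mul_one]
    exact congrArg _ (Set.projIcc_val _ s).symm
  refine ⟨ε, hε, V', hV', hx₀, fun z => v z one, ?_, ?_, ?_⟩
  · have h1 : ContDiff ℝ ∞ (fun w : C(Time, E) => w one) :=
      (ContinuousMap.evalCLM ℝ (M := E) one).contDiff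
    exact h1.comp_contDiffOn (hv.mono fun z hz => hmem z.1 (abs_lt.2 hz.1) z.2 hz.2)
  · intro x hx
    simpa using hsol 0 (by simpa using hε) x hx one
  · intro x hx t ht
    -- With `T` fixed beyond `|t|`, the flow near time `t` is `s ↦ v (T, x) (s / T)` at interior
    -- parameters, and the integral equation can be differentiated.
    obtain ⟨T, hT1, hT2⟩ := exists_between (abs_lt.2 ht)
    have hT : 0 < T := (abs_nonneg t).trans_lt hT1
    have hTε : |T| < ε := by rwa [abs_of_pos hT]
    have hcont : Continuous fun τ : ℝ => f (v (T, x) (toTime τ)) :=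
      hf.continuous.comp ((v (T, x)).continuous.comp continuous_projIcc)
    have hd : HasDerivAt (fun s : ℝ => x + T • ∫ τ in (0 : ℝ)..s / T, f (v (T, x) (toTime τ)))
        (f (v (T, x) (toTime (t / T)))) t := by
      have h1 := (hcont.integral_hasStrictDerivAt 0 (t / T)).hasDerivAt
      have h2 := (h1.scomp t ((hasDerivAt_id t).div_const T)).const_smul T
      rw [smul_smul, mul_one_div_cancel hT.ne', one_smul] at h2
      exact h2.const_add x
    have hval : ∀ s, |s| < T → v (T, x) (toTime (s / T)) = v (s, x) one := by
      intro s hs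
      have h1 : s / T ∈ Set.Icc (-1 : ℝ) 1 := by
        rw [abs_lt] at hs
        constructor
        · rw [le_div_iff₀ hT]; linarith
        · rw [div_le_iff₀ hT]; linarith
      have h2 := hscale T hTε x hx (toTime (s / T))
      rw [show (toTime (s / T) : ℝ) = s / T from congrArg Subtype.val (Set.projIcc_of_mem _ h1),
        mul_div_cancel₀ _ hT.ne'] at h2
      exact h2
    rw [hval t hT1] at hd
    refine hd.congr_of_eventuallyEq ?_
    filter_upwards [(continuous_abs.isOpen_preimage _ isOpen_Iio).mem_nhds
      (show t ∈ abs ⁻¹' Set.Iio T from hT1)] with s hs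
    rw [← hval s hs, hsol T hTε x hx]
    have h1 : s / T ∈ Set.Icc (-1 : ℝ) 1 := by
      have hs' := abs_lt.1 (show |s| < T from hs)
      constructor
      · rw [le_div_iff₀ hT]; linarith
      · rw [div_le_iff₀ hT]; linarith
    rw [show (toTime (s / T) : ℝ) = s / T from congrArg Subtype.val (Set.projIcc_of_mem _ h1)]

end Flow

/-! ### Vector fields and differentials in charts -/

section Charts

variable {M : Type*} [TopologicalSpace M] [ChartedSpace E3 M] [IsManifold (𝓡 3) ∞ M]

/-- The differential at `p` of the chart around `q`. -/
def chartD (q p : M) : TangentSpace (𝓡 3) p →L[ℝ] E3 :=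
  mfderiv (𝓡 3) 𝓘(ℝ, E3) (extChartAt (𝓡 3) q) p

/-- The inverse of the differential at `p` of the chart around `q`. -/
def chartInv (q p : M) : E3 →L[ℝ] TangentSpace (𝓡 3) p :=
  (mfderiv (𝓡 3) 𝓘(ℝ, E3) (extChartAt (𝓡 3) q) p).inverse

/-- The coordinate expression of the vector field `X` in the chart around `q`. -/
def VField.inChart (X : VField M) (q : M) (x : E3) : E3 :=
  chartD q ((extChartAt (𝓡 3) q).symm x) (X ((extChartAt (𝓡 3) q).symm x))

theorem mfderiv_chart_comp_symm {q : M} {x : E3} (hx : x ∈ (extChartAt (𝓡 3) q).target) :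
    (mfderiv (𝓡 3) 𝓘(ℝ, E3) (extChartAt (𝓡 3) q) ((extChartAt (𝓡 3) q).symm x)).comp
      (mfderiv 𝓘(ℝ, E3) (𝓡 3) (extChartAt (𝓡 3) q).symm x) = ContinuousLinearMap.id ℝ _ := by
  have := mfderiv_extChartAt_comp_mfderivWithin_extChartAt_symm hx
  rwa [ModelWithCorners.Boundaryless.range_eq_univ, mfderivWithin_univ] at this

theorem mfderiv_symm_comp_chart {q : M} {x : E3} (hx : x ∈ (extChartAt (𝓡 3) q).target) :
    (mfderiv 𝓘(ℝ, E3) (𝓡 3) (extChartAt (𝓡 3) q).symm x).comp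
      (mfderiv (𝓡 3) 𝓘(ℝ, E3) (extChartAt (𝓡 3) q) ((extChartAt (𝓡 3) q).symm x)) =
      ContinuousLinearMap.id ℝ _ := by
  have := mfderivWithin_extChartAt_symm_comp_mfderiv_extChartAt hx
  rwa [ModelWithCorners.Boundaryless.range_eq_univ, mfderivWithin_univ] at this

theorem symm_chart_apply {q : M} {x : E3} (hx : x ∈ (extChartAt (𝓡 3) q).target)
    (v : TangentSpace (𝓡 3) ((extChartAt (𝓡 3) q).symm x)) :
    mfderiv 𝓘(ℝ, E3) (𝓡 3) (extChartAt (𝓡 3) q).symm x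
      (mfderiv (𝓡 3) 𝓘(ℝ, E3) (extChartAt (𝓡 3) q) ((extChartAt (𝓡 3) q).symm x) v) = v :=
  DFunLike.congr_fun (mfderiv_symm_comp_chart hx) v

theorem chartInv_symm {q : M} {x : E3} (hx : x ∈ (extChartAt (𝓡 3) q).target) :
    chartInv q ((extChartAt (𝓡 3) q).symm x) =
      mfderiv 𝓘(ℝ, E3) (𝓡 3) (extChartAt (𝓡 3) q).symm x :=
  ContinuousLinearMap.inverse_eq (mfderiv_chart_comp_symm hx) (mfderiv_symm_comp_chart hx)

theorem chartD_chartInv {q p : M} (hp : p ∈ (extChartAt (𝓡 3) q).source) (u : E3) :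
    chartD q p (chartInv q p u) = u :=
  (isInvertible_mfderiv_extChartAt hp).self_apply_inverse u

theorem chartInv_chartD {q p : M} (hp : p ∈ (extChartAt (𝓡 3) q).source)
    (v : TangentSpace (𝓡 3) p) :
    chartInv q p (chartD q p v) = v :=
  (isInvertible_mfderiv_extChartAt hp).inverse_apply_self v

theorem mfderiv_symm_inChart {X : VField M} {q : M} {x : E3}
    (hx : x ∈ (extChartAt (𝓡 3) q).target) :
    mfderiv 𝓘(ℝ, E3) (𝓡 3) (extChartAt (𝓡 3) q).symm x (X.inChart q x) =
      X ((extChartAt (𝓡 3) q).symm x) :=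
  symm_chart_apply hx _

theorem contMDiffAt_symm {q : M} {x : E3} (hx : x ∈ (extChartAt (𝓡 3) q).target) :
    ContMDiffAt 𝓘(ℝ, E3) (𝓡 3) ∞ (extChartAt (𝓡 3) q).symm x :=
  (contMDiffOn_extChartAt_symm q).contMDiffAt ((isOpen_extChartAt_target q).mem_nhds hx)

theorem contMDiffAt_chart {q p : M} (hp : p ∈ (extChartAt (𝓡 3) q).source) :
    ContMDiffAt (𝓡 3) 𝓘(ℝ, E3) ∞ (extChartAt (𝓡 3) q) p :=
  contMDiffAt_extChartAt' (by rwa [extChartAt_source] at hp)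

/-- The coordinate expression is the pull back of `X` by the inverse chart. -/
theorem VField.SmoothOn.contDiffOn_inChart {X : VField M} {U : Set M} (hX : X.SmoothOn U)
    (hU : IsOpen U) (q : M) :
    ContDiffOn ℝ ∞ (X.inChart q)
      ((extChartAt (𝓡 3) q).target ∩ (extChartAt (𝓡 3) q).symm ⁻¹' U) := by
  intro x hx
  have h1 := ContMDiffAt.mpullback_vectorField_preimage (f := (extChartAt (𝓡 3) q).symm)
    (V := X) (m := ∞) (n := ∞) (x₀ := x) (hX.contMDiffAt (hU.mem_nhds hx.2))
    (contMDiffAt_symm hx.1) (ContinuousLinearMap.IsInvertible.of_inverse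
      (mfderiv_symm_comp_chart hx.1) (mfderiv_chart_comp_symm hx.1)) (by simp)
  rw [contMDiffAt_vectorSpace_iff_contDiffAt] at h1
  refine (h1.congr_of_eventuallyEq ?_).contDiffWithinAt
  filter_upwards [(isOpen_extChartAt_target q).mem_nhds hx.1] with y hy
  rw [VectorField.mpullback_apply]
  exact (DFunLike.congr_fun (ContinuousLinearMap.inverse_eq
    (mfderiv_symm_comp_chart hy) (mfderiv_chart_comp_symm hy)) _).symm

/-- These are the pull backs of constant fields by the chart. They serve as test fields for the
smoothness of tensors. -/
theorem smoothOn_chartInv (q : M) (u : E3) :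
    VField.SmoothOn (fun p => chartInv q p u) (extChartAt (𝓡 3) q).source := by
  intro p hp
  have h1 : ContMDiffAt 𝓘(ℝ, E3) 𝓘(ℝ, E3).tangent ∞
      (fun x : E3 => (⟨x, u⟩ : TangentBundle 𝓘(ℝ, E3) E3)) (extChartAt (𝓡 3) q p) :=
    contMDiffAt_vectorSpace_iff_contDiffAt.2 contDiffAt_const
  exact (ContMDiffAt.mpullback_vectorField_preimage h1 (contMDiffAt_chart hp)
    (isInvertible_mfderiv_extChartAt hp) (m := ∞) (n := ∞) (by simp)).contMDiffWithinAt

end Charts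

/-! ### Local flows on the manifold -/

section LocalFlow

/-- Cutting off a smooth map near a point. -/
theorem exists_contDiff_cutoff {E F : Type*} [NormedAddCommGroup E] [NormedSpace ℝ E]
    [FiniteDimensional ℝ E] [NormedAddCommGroup F] [NormedSpace ℝ F] {f : E → F} {U : Set E}
    (hU : IsOpen U) (hf : ContDiffOn ℝ ∞ f U) {x₀ : E} (hx₀ : x₀ ∈ U) :
    ∃ f' : E → F, ContDiff ℝ ∞ f' ∧ HasCompactSupport f' ∧ f' =ᶠ[𝓝 x₀] f := by
  obtain ⟨r, hr, hrU⟩ := Metric.nhds_basis_closedBall.mem_iff.1 (hU.mem_nhds hx₀)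
  let b : ContDiffBump x₀ := ⟨r / 2, r, by positivity, by linarith⟩
  refine ⟨fun x => b x • f x, ?_, b.hasCompactSupport.smul_right, ?_⟩
  · rw [contDiff_iff_contDiffAt]
    intro x
    by_cases hx : x ∈ U
    · exact b.contDiffAt.smul (hf.contDiffAt (hU.mem_nhds hx))
    · refine (contDiffAt_const (c := (0 : F))).congr_of_eventuallyEq ?_
      filter_upwards [Metric.isClosed_closedBall.isOpen_compl.mem_nhds
        (show x ∈ (Metric.closedBall x₀ r)ᶜ from fun h => hx (hrU h))] with y hy
      rw [b.zero_of_le_dist, zero_smul]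
      exact (not_le.1 fun h => hy (Metric.mem_closedBall.2 h)).le
  · filter_upwards [b.eventuallyEq_one] with y hy
    rw [hy, Pi.one_apply, one_smul]

variable {M : Type*} [TopologicalSpace M] [ChartedSpace E3 M] [IsManifold (𝓡 3) ∞ M]

/-- Local flows of smooth vector fields exist. -/
theorem exists_isLocalFlow {X : VField M} (hX : X.SmoothOn Set.univ) (q : M) :
    ∃ (J : Set ℝ) (U : Set M) (ψ : ℝ → M → M), IsLocalFlow X J U ψ ∧ q ∈ U := by
  let φ := extChartAt (𝓡 3) q
  have hφt : IsOpen φ.target := isOpen_extChartAt_target q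
  have hq : q ∈ φ.source := mem_extChartAt_source q
  -- Compact support makes the coordinate field globally Lipschitz. The flow is later confined to
  -- `W`, where the cutoff changes nothing.
  obtain ⟨f, hf, hfc, hfX⟩ := exists_contDiff_cutoff hφt
    ((hX.contDiffOn_inChart isOpen_univ q).mono fun x hx => ⟨hx, trivial⟩) (φ.map_source hq)
  obtain ⟨k, hk⟩ := hf.lipschitzWith_of_hasCompactSupport hfc (by simp)
  obtain ⟨ε, hε, V, hV, hqV, ψ, hψ, hψ0, hψd⟩ := exists_smooth_flow hf hk (φ q)
  obtain ⟨W, hW, hWo, hqW⟩ := eventually_nhds_iff.1 (hfX.and (hφt.eventually_mem (φ.map_source hq)))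
  have h0 : ((0 : ℝ), φ q) ∈ Set.Ioo (-ε) ε ×ˢ V := ⟨⟨by linarith, hε⟩, hqV⟩
  have hopen : IsOpen (Set.Ioo (-ε) ε ×ˢ V) := isOpen_Ioo.prod hV
  have hpre : ψ ⁻¹' W ∈ 𝓝 ((0 : ℝ), φ q) :=
    (hψ.continuousOn.continuousAt (hopen.mem_nhds h0)).preimage_mem_nhds
      (hWo.mem_nhds (by rw [hψ0 _ hqV]; exact hqW))
  obtain ⟨A, hA, V₁, hV₁, hAV⟩ := mem_nhds_prod_iff.1 (Filter.inter_mem hpre (hopen.mem_nhds h0))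
  obtain ⟨V₂, hV₂, hV₂o, hqV₂⟩ := mem_nhds_iff.1 hV₁
  obtain ⟨δ, hδ, hδA⟩ := Metric.mem_nhds_iff.1 hA
  rw [Real.ball_eq_Ioo, zero_sub, zero_add] at hδA
  have hsub : ∀ t ∈ Set.Ioo (-δ) δ, ∀ x ∈ V₂, ψ (t, x) ∈ W ∧ (t, x) ∈ Set.Ioo (-ε) ε ×ˢ V :=
    fun t ht x hx => hAV ⟨hδA ht, hV₂ hx⟩
  let U : Set M := φ.source ∩ φ ⁻¹' V₂
  have hU : IsOpen U := isOpen_extChartAt_preimage' q hV₂o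
  refine ⟨Set.Ioo (-δ) δ, U, fun t p => φ.symm (ψ (t, φ p)),
    ⟨isOpen_Ioo, Set.ordConnected_Ioo, ⟨by linarith, hδ⟩, hU, ?_, ?_, ?_⟩, hq, hqV₂⟩
  · rintro ⟨t, p⟩ ⟨ht, hp⟩
    obtain ⟨h1, h2⟩ := hsub t ht _ hp.2
    have h3 : ContMDiffAt 𝓘(ℝ, E3) (𝓡 3) ∞ φ.symm (ψ (t, φ p)) := contMDiffAt_symm (hW _ h1).2
    have h4 : ContMDiffAt 𝓘(ℝ, ℝ × E3) 𝓘(ℝ, E3) ∞ ψ (t, φ p) :=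
      (hψ.contDiffAt (hopen.mem_nhds h2)).contMDiffAt
    have h5 : ContMDiffAt (𝓘(ℝ, ℝ).prod (𝓡 3)) 𝓘(ℝ, ℝ × E3) ∞
        (fun z : ℝ × M => (z.1, φ z.2)) (t, p) :=
      contMDiffAt_fst.prodMk_space ((contMDiffAt_chart hp.1).comp (t, p) contMDiffAt_snd)
    exact (h3.comp (t, p) (h4.comp (t, p) h5)).contMDiffWithinAt
  · intro p hp
    have h1 : φ p ∈ V := (hsub 0 ⟨by linarith, hδ⟩ _ hp.2).2.2
    change φ.symm (ψ (0, φ p)) = p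
    rw [hψ0 _ h1, φ.left_inv hp.1]
  · intro p hp t ht
    obtain ⟨h1, h2⟩ := hsub t ht _ hp.2
    have h3 := (hψd _ h2.2 t h2.1).hasFDerivAt.hasMFDerivAt
    have h4 : MDifferentiableAt 𝓘(ℝ, E3) (𝓡 3) φ.symm (ψ (t, φ p)) :=
      (contMDiffAt_symm (hW _ h1).2).mdifferentiableAt (by simp)
    have h5 := h4.hasMFDerivAt.comp t h3
    refine (h5.congr_mfderiv ?_).hasMFDerivWithinAt
    refine ContinuousLinearMap.ext fun (s : ℝ) => ?_
    have h6 := mfderiv_symm_inChart (X := X) (hW _ h1).2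
    rw [← (hW _ h1).1] at h6
    exact (ContinuousLinearMap.map_smul (mfderiv 𝓘(ℝ, E3) (𝓡 3) φ.symm (ψ (t, φ p))) s _).trans
      (congrArg (s • ·) h6)

end LocalFlow

/-! ### Variational equation and Lie derivative in a normed space -/

section Variation

variable {E E' : Type*} [NormedAddCommGroup E] [NormedSpace ℝ E]
  [NormedAddCommGroup E'] [NormedSpace ℝ E']

/-- The variational equation along a flow. -/
theorem hasDerivAt_variation {F : ℝ × E → E'} {f : E' → E'} {z : ℝ × E}
    (hF : ContDiffAt ℝ 2 F z) (hf : DifferentiableAt ℝ f (F z))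
    (hode : ∀ᶠ z' in 𝓝 z, fderiv ℝ F z' (1, 0) = f (F z')) (v : E) :
    HasDerivAt (fun s => fderiv ℝ F (s, z.2) (0, v)) (fderiv ℝ f (F z) (fderiv ℝ F z (0, v)))
      z.1 := by
  have hF' : DifferentiableAt ℝ (fderiv ℝ F) z :=
    (hF.fderiv_right (m := 1) (by norm_num)).differentiableAt (by norm_num)
  have hsymm : IsSymmSndFDerivAt ℝ F z := hF.isSymmSndFDerivAt (by simp)
  have h1 : HasFDerivAt (fun z' => fderiv ℝ F z' (1, 0))
      ((fderiv ℝ f (F z)).comp (fderiv ℝ F z)) z :=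
    (hf.hasFDerivAt.comp z (hF.differentiableAt (by norm_num)).hasFDerivAt).congr_of_eventuallyEq
      hode
  have h2 := hF'.hasFDerivAt.clm_apply (hasFDerivAt_const ((1 : ℝ), (0 : E)) z)
  -- This is the flow equation differentiated in the space direction `v`; symmetry of the second
  -- derivative then exchanges time and space.
  have h3 : fderiv ℝ (fderiv ℝ F) z (0, v) (1, 0) = fderiv ℝ f (F z) (fderiv ℝ F z (0, v)) := by
    simpa using DFunLike.congr_fun (h2.unique h1) (0, v)
  have h4 : HasDerivAt (fun s : ℝ => (s, z.2)) ((1 : ℝ), (0 : E)) z.1 :=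
    (hasDerivAt_id z.1).prodMk (hasDerivAt_const z.1 z.2)
  have h5 : HasDerivAt (fun s : ℝ => fderiv ℝ F (s, z.2)) (fderiv ℝ (fderiv ℝ F) z (1, 0)) z.1 :=
    HasFDerivAt.comp_hasDerivAt z.1 (f := fun s : ℝ => (s, z.2)) hF'.hasFDerivAt h4
  have h6 := h5.clm_apply (hasDerivAt_const z.1 ((0 : ℝ), v))
  rw [← h3, hsymm.eq]
  simpa using h6

/-- The Lie derivative along `f` of the field `β` of bilinear forms on a normed space. -/
def lieBilin (f : E → E) (β : E → E →L[ℝ] E →L[ℝ] ℝ) (x : E) : E →L[ℝ] E →L[ℝ] ℝ :=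
  fderiv ℝ β x (f x) + (β x).comp (fderiv ℝ f x) + ((β x).flip.comp (fderiv ℝ f x)).flip

theorem lieBilin_apply (f : E → E) (β : E → E →L[ℝ] E →L[ℝ] ℝ) (x u v : E) :
    lieBilin f β x u v =
      fderiv ℝ β x (f x) u v + β x (fderiv ℝ f x u) v + β x u (fderiv ℝ f x v) := rfl

theorem hasDerivAt_comp_curve {G : Type*} [NormedAddCommGroup G] [NormedSpace ℝ G] {β : E → G}
    {y : ℝ → E} {y' : E} {t : ℝ} (hβ : DifferentiableAt ℝ β (y t)) (hy : HasDerivAt y y' t) :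
    HasDerivAt (fun s => β (y s)) (fderiv ℝ β (y t) y') t :=
  hβ.hasFDerivAt.comp_hasDerivAt t hy

-- By the product rule, the coefficient and the two arguments contribute the three terms of
-- `lieBilin`.
set_option synthInstance.maxHeartbeats 100000 in
theorem hasDerivAt_bilin_variation {F : ℝ × E → E'} {f : E' → E'} {β : E' → E' →L[ℝ] E' →L[ℝ] ℝ}
    {z : ℝ × E} (hF : ContDiffAt ℝ 2 F z) (hf : DifferentiableAt ℝ f (F z))
    (hβ : DifferentiableAt ℝ β (F z))
    (hode : ∀ᶠ z' in 𝓝 z, fderiv ℝ F z' (1, 0) = f (F z')) (v w : E) :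
    HasDerivAt (fun s => β (F (s, z.2)) (fderiv ℝ F (s, z.2) (0, v)) (fderiv ℝ F (s, z.2) (0, w)))
      (lieBilin f β (F z) (fderiv ℝ F z (0, v)) (fderiv ℝ F z (0, w))) z.1 := by
  obtain ⟨t, x⟩ := z
  have hy : HasDerivAt (fun s => F (s, x)) (f (F (t, x))) t := by
    rw [← hode.self_of_nhds]
    exact HasFDerivAt.comp_hasDerivAt t (f := fun s : ℝ => (s, x))
      (hF.differentiableAt (by norm_num)).hasFDerivAt
      ((hasDerivAt_id t).prodMk (hasDerivAt_const t x))
  have h1 : HasDerivAt (fun s => β (F (s, x))) (fderiv ℝ β (F (t, x)) (f (F (t, x)))) t :=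
    hasDerivAt_comp_curve (G := E' →L[ℝ] E' →L[ℝ] ℝ) hβ hy
  exact ((h1.clm_apply (hasDerivAt_variation hF hf hode v)).clm_apply
    (hasDerivAt_variation hF hf hode w)).congr_deriv (by simp [lieBilin_apply])

end Variation

/-! ### Lie derivatives of bilinear forms along flows on the manifold -/

variable {M : Type*} [TopologicalSpace M] [ChartedSpace E3 M]

/-- The coordinate expression of a field of bilinear forms in the chart around `q`. -/
def bilinInChart (b : ∀ q : M, LinearMap.BilinForm ℝ (TangentSpace (𝓡 3) q)) (q : M) (x : E3) :
    E3 →L[ℝ] E3 →L[ℝ] ℝ :=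
  LinearMap.toContinuousBilinearMap ((b ((extChartAt (𝓡 3) q).symm x)).compl₁₂
    (chartInv q ((extChartAt (𝓡 3) q).symm x)).toLinearMap
    (chartInv q ((extChartAt (𝓡 3) q).symm x)).toLinearMap)

theorem bilinInChart_apply (b : ∀ q : M, LinearMap.BilinForm ℝ (TangentSpace (𝓡 3) q)) (q : M)
    (x u v : E3) : bilinInChart b q x u v =
      b ((extChartAt (𝓡 3) q).symm x) (chartInv q _ u) (chartInv q _ v) := rfl

theorem bilinInChart_chart (b : ∀ q : M, LinearMap.BilinForm ℝ (TangentSpace (𝓡 3) q)) {q p : M}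
    (hp : p ∈ (extChartAt (𝓡 3) q).source) (u v : E3) :
    bilinInChart b q (extChartAt (𝓡 3) q p) u v = b p (chartInv q p u) (chartInv q p v) := by
  rw [bilinInChart_apply, (extChartAt (𝓡 3) q).left_inv hp]

theorem bilinInChart_chartD [IsManifold (𝓡 3) ∞ M] (b : ∀ q : M, LinearMap.BilinForm ℝ (TangentSpace (𝓡 3) q))
    {q p : M} (hp : p ∈ (extChartAt (𝓡 3) q).source) (u v : TangentSpace (𝓡 3) p) :
    bilinInChart b q (extChartAt (𝓡 3) q p) (chartD q p u) (chartD q p v) = b p u v := by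
  rw [bilinInChart_chart b hp, chartInv_chartD hp, chartInv_chartD hp]

theorem VField.inChart_chart (X : VField M) {q p : M} (hp : p ∈ (extChartAt (𝓡 3) q).source) :
    X.inChart q (extChartAt (𝓡 3) q p) = chartD q p (X p) := by
  rw [VField.inChart, (extChartAt (𝓡 3) q).left_inv hp]

/-- The Lie derivative at `q` of a field of bilinear forms, in the chart around `q`. -/
def lieAt (X : VField M) (b : ∀ q : M, LinearMap.BilinForm ℝ (TangentSpace (𝓡 3) q)) (q : M)
    (u v : TangentSpace (𝓡 3) q) : ℝ :=
  lieBilin (X.inChart q) (bilinInChart b q) (extChartAt (𝓡 3) q q) (chartD q q u) (chartD q q v)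

theorem IsLocalFlow.contMDiffAt {X : VField M} {J : Set ℝ} {U : Set M} {ψ : ℝ → M → M}
    (h : IsLocalFlow X J U ψ) {t : ℝ} (ht : t ∈ J) {p : M} (hp : p ∈ U) :
    ContMDiffAt (𝓘(ℝ, ℝ).prod (𝓡 3)) (𝓡 3) ∞ (fun z : ℝ × M => ψ z.1 z.2) (t, p) :=
  h.smooth.contMDiffAt ((h.open_J.prod h.open_U).mem_nhds ⟨ht, hp⟩)

theorem IsLocalFlow.contMDiffAt_right {X : VField M} {J : Set ℝ} {U : Set M} {ψ : ℝ → M → M}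
    (h : IsLocalFlow X J U ψ) {t : ℝ} (ht : t ∈ J) {p : M} (hp : p ∈ U) :
    ContMDiffAt (𝓡 3) (𝓡 3) ∞ (ψ t) p :=
  ContMDiffAt.comp p (f := fun p : M => (t, p)) (h.contMDiffAt ht hp)
    (contMDiffAt_const.prodMk contMDiffAt_id)

/-- The derivative of the pull back of a field of bilinear forms along a flow is the pull back of
the Lie derivative. -/
theorem IsLocalFlow.hasDerivAt_pullback [IsManifold (𝓡 3) ∞ M] {X : VField M}
    (hX : X.SmoothOn Set.univ) {J : Set ℝ}
    {U : Set M} {ψ : ℝ → M → M} (h : IsLocalFlow X J U ψ) {t : ℝ} (ht : t ∈ J) {p : M} (hp : p ∈ U)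
    {b : ∀ q : M, LinearMap.BilinForm ℝ (TangentSpace (𝓡 3) q)}
    (hb : DifferentiableAt ℝ (bilinInChart b (ψ t p)) (extChartAt (𝓡 3) (ψ t p) (ψ t p)))
    (v w : TangentSpace (𝓡 3) p) :
    HasDerivAt (fun s => b (ψ s p) (mfderiv (𝓡 3) (𝓡 3) (ψ s) p v)
        (mfderiv (𝓡 3) (𝓡 3) (ψ s) p w))
      (lieAt X b (ψ t p) (mfderiv (𝓡 3) (𝓡 3) (ψ t) p v) (mfderiv (𝓡 3) (𝓡 3) (ψ t) p w)) t := by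
  set q := ψ t p with hq
  let φ := extChartAt (𝓡 3) q
  let χ := extChartAt (𝓡 3) p
  -- The charts are those around `p` and around the endpoint at time `t`; both stay fixed while the
  -- time varies near `t`.
  let F : ℝ × E3 → E3 := fun z => φ (ψ z.1 (χ.symm z.2))
  have hpχ : p ∈ χ.source := mem_extChartAt_source p
  have hqφ : q ∈ φ.source := mem_extChartAt_source q
  let x₁ := χ p
  have hx₁ : χ.symm x₁ = p := χ.left_inv hpχ
  -- the domain on which `F` is the coordinate expression of the flow
  have hgood : ∀ s x, s ∈ J → x ∈ χ.target → χ.symm x ∈ U → ψ s (χ.symm x) ∈ φ.source →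
      ContDiffAt ℝ ∞ F (s, x) := by
    intro s x hs hx hxU hsx
    have h3 : ContMDiffAt 𝓘(ℝ, ℝ × E3) (𝓘(ℝ, ℝ).prod (𝓡 3)) ∞
        (fun z : ℝ × E3 => (z.1, χ.symm z.2)) (s, x) :=
      contDiffAt_fst.contMDiffAt.prodMk
        (ContMDiffAt.comp (s, x) (contMDiffAt_symm hx) contDiffAt_snd.contMDiffAt)
    have h4 := ContMDiffAt.comp (s, x) (f := fun z : ℝ × E3 => (z.1, χ.symm z.2))
      (h.contMDiffAt hs hxU) h3
    exact (ContMDiffAt.comp (s, x) (contMDiffAt_chart hsx) h4).contDiffAt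
  have hev : ∀ᶠ z : ℝ × E3 in 𝓝 (t, x₁), z.1 ∈ J ∧ z.2 ∈ χ.target ∧ χ.symm z.2 ∈ U ∧
      ψ z.1 (χ.symm z.2) ∈ φ.source := by
    have h3 : ContMDiffAt 𝓘(ℝ, ℝ × E3) (𝓘(ℝ, ℝ).prod (𝓡 3)) ∞
        (fun z : ℝ × E3 => (z.1, χ.symm z.2)) (t, x₁) :=
      contDiffAt_fst.contMDiffAt.prodMk
        (ContMDiffAt.comp (t, x₁) (contMDiffAt_symm (χ.map_source hpχ)) contDiffAt_snd.contMDiffAt)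
    have h4 := ContMDiffAt.comp (t, x₁) (f := fun z : ℝ × E3 => (z.1, χ.symm z.2))
      (h.contMDiffAt ht (p := χ.symm x₁) (by rwa [hx₁])) h3
    have h5 := h3.continuousAt.snd
    refine (continuousAt_fst.eventually_mem (h.open_J.mem_nhds ht)).and
      ((continuousAt_snd.eventually_mem ((isOpen_extChartAt_target p).mem_nhds
        (χ.map_source hpχ))).and
      ((h5.eventually_mem (h.open_U.mem_nhds ?_)).and
      (h4.continuousAt.eventually_mem ((isOpen_extChartAt_source q).mem_nhds ?_))))
    · change χ.symm x₁ ∈ U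
      rwa [hx₁]
    · change ψ t (χ.symm x₁) ∈ φ.source
      rwa [hx₁]
  have hcenter := hev.self_of_nhds
  have hFc : ContDiffAt ℝ ∞ F (t, x₁) := hgood _ _ hcenter.1 hcenter.2.1 hcenter.2.2.1 hcenter.2.2.2
  have hFq : F (t, x₁) = φ q := by
    change φ (ψ t (χ.symm x₁)) = φ q
    rw [hx₁]
  -- the flow equation in coordinates
  have htime : ∀ s x, s ∈ J → x ∈ χ.target → χ.symm x ∈ U → ψ s (χ.symm x) ∈ φ.source →
      fderiv ℝ F (s, x) (1, 0) = X.inChart q (F (s, x)) := by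
    intro s x hs hx hxU hsx
    have h1 : HasDerivAt (fun s' => F (s', x)) (fderiv ℝ F (s, x) (1, 0)) s :=
      HasFDerivAt.comp_hasDerivAt s (f := fun s' : ℝ => (s', x))
        ((hgood s x hs hx hxU hsx).differentiableAt (by simp)).hasFDerivAt
        ((hasDerivAt_id s).prodMk (hasDerivAt_const s x))
    have h2 := (h.integral _ hxU s hs).hasMFDerivAt (h.open_J.mem_nhds hs)
    have h3 := (((contMDiffAt_chart hsx).mdifferentiableAt (by simp)).hasMFDerivAt).comp s h2
    have h4 : HasFDerivAt (fun s' => F (s', x)) ((chartD q (ψ s (χ.symm x))).comp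
        ((1 : ℝ →L[ℝ] ℝ).smulRight (X (ψ s (χ.symm x))))) s := h3.hasFDerivAt
    rw [h1.unique h4.hasDerivAt]
    change _ = X.inChart q (φ (ψ s (χ.symm x)))
    rw [VField.inChart_chart X hsx]
    exact congrArg (chartD q (ψ s (χ.symm x))) (one_smul ℝ (X (ψ s (χ.symm x))))
  -- the differential of the flow in coordinates
  have hspace : ∀ s, s ∈ J → ψ s p ∈ φ.source → ∀ v : TangentSpace (𝓡 3) p,
      fderiv ℝ F (s, x₁) (0, chartD p p v) =
        chartD q (ψ s p) (mfderiv (𝓡 3) (𝓡 3) (ψ s) p v) := by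
    intro s hs hsp v
    have h1 : HasFDerivAt (fun x => F (s, x))
        ((fderiv ℝ F (s, x₁)).comp (ContinuousLinearMap.inr ℝ ℝ E3)) x₁ :=
      HasFDerivAt.comp x₁ (f := fun x : E3 => (s, x))
        ((hgood s x₁ hs (χ.map_source hpχ) (by rwa [hx₁]) (by rwa [hx₁])).differentiableAt
          (by simp)).hasFDerivAt (hasFDerivAt_prodMk_right _ _)
    have h2 := h1.hasMFDerivAt.comp p
      ((contMDiffAt_chart hpχ).mdifferentiableAt (by simp)).hasMFDerivAt
    have h3 := ((contMDiffAt_chart hsp).mdifferentiableAt (by simp)).hasMFDerivAt.comp p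
      ((h.contMDiffAt_right hs hp).mdifferentiableAt (by simp)).hasMFDerivAt
    have h4 : (φ ∘ ψ s) =ᶠ[𝓝 p] ((fun x => F (s, x)) ∘ χ) := by
      filter_upwards [(isOpen_extChartAt_source p).mem_nhds hpχ] with p' hp'
      change φ (ψ s p') = φ (ψ s (χ.symm (χ p')))
      rw [χ.left_inv hp']
    exact (DFunLike.congr_fun (hasMFDerivAt_unique (h3.congr_of_eventuallyEq h4.symm) h2) v).symm
  have hode : ∀ᶠ z in 𝓝 (t, x₁), fderiv ℝ F z (1, 0) = X.inChart q (F z) :=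
    hev.mono fun z hz => htime z.1 z.2 hz.1 hz.2.1 hz.2.2.1 hz.2.2.2
  have hfd : DifferentiableAt ℝ (X.inChart q) (F (t, x₁)) := by
    rw [hFq]
    have := hX.contDiffOn_inChart isOpen_univ q
    exact (this.contDiffAt (((isOpen_extChartAt_target q).inter (by simp)).mem_nhds
      ⟨φ.map_source hqφ, trivial⟩)).differentiableAt (by simp)
  have hmain := hasDerivAt_bilin_variation (β := bilinInChart b q)
    (contDiffAt_infty.1 hFc 2) hfd (by rwa [hFq]) hode (chartD p p v)
    (chartD p p w)
  have hval := hmain.congr_of_eventuallyEq (f₁ := fun s => b (ψ s p)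
    (mfderiv (𝓡 3) (𝓡 3) (ψ s) p v) (mfderiv (𝓡 3) (𝓡 3) (ψ s) p w)) (by
      have hc : Filter.Tendsto (fun s : ℝ => (s, x₁)) (𝓝 t) (𝓝 (t, x₁)) :=
        (Continuous.prodMk_left x₁).tendsto t
      filter_upwards [hc.eventually hev] with s hs
      have hs' : ψ s p ∈ φ.source := by
        have := hs.2.2.2
        rwa [hx₁] at this
      have hFs : F (s, x₁) = φ (ψ s p) := by
        change φ (ψ s (χ.symm x₁)) = _
        rw [hx₁]
      rw [hspace s hs.1 hs', hspace s hs.1 hs', hFs]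
      exact (bilinInChart_chartD b hs' _ _).symm)
  refine hval.congr_deriv ?_
  rw [hFq, hspace t ht hqφ, hspace t ht hqφ]
  rfl

/-! ### Coordinate computations: Lie derivatives and the Poisson bracket -/

section Coordinates

variable {E : Type*} [NormedAddCommGroup E] [NormedSpace ℝ E]
  {f : E → E} {a : E → E →L[ℝ] ℝ} {γ : E → E →L[ℝ] E →L[ℝ] ℝ} {x₀ : E}

/-- The differential of `Q` is the linear map `C + C.flip`, so the second derivative is constant. -/
theorem polarization_eq {W : Type*} [NormedAddCommGroup W] [NormedSpace ℝ W] {Q : W → ℝ}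
    {C : W →L[ℝ] W →L[ℝ] ℝ} (hQ : ∀ w, Q w = C w w) (a b : W) :
    polarization Q a b = (1 / 2) * (C a b + C b a) := by
  have h1 : fderiv ℝ Q = ⇑(C + C.flip) := by
    funext w
    have h2 : HasFDerivAt Q ((C + C.flip) w) w := by
      rw [show Q = fun w => C w w from funext hQ]
      refine (C.hasFDerivAt.clm_apply (hasFDerivAt_id w)).congr_fderiv ?_
      ext v
      simp
    exact h2.fderiv
  change (1 / 2) * fderiv ℝ (fderiv ℝ Q) 0 a b = _
  rw [h1, ContinuousLinearMap.fderiv]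
  simp

/-- The Lie derivative of `a` along `f` vanishes if `a f = 1` and `da (f, ·) = 0`. -/
theorem lie_covector_eq_zero (hf : DifferentiableAt ℝ f x₀) (ha : DifferentiableAt ℝ a x₀)
    (h1 : ∀ᶠ x in 𝓝 x₀, a x (f x) = 1)
    (hd : ∀ v, fderiv ℝ a x₀ (f x₀) v - fderiv ℝ a x₀ v (f x₀) = 0) (v : E) :
    fderiv ℝ a x₀ (f x₀) v + a x₀ (fderiv ℝ f x₀ v) = 0 := by
  have h2 := ha.hasFDerivAt.clm_apply hf.hasFDerivAt
  have h3 := h2.unique ((hasFDerivAt_const (1 : ℝ) x₀).congr_of_eventuallyEq h1)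
  have h4 := DFunLike.congr_fun h3 v
  simp at h4
  linarith [hd v]

theorem fderiv_bilin_apply (hγ : DifferentiableAt ℝ γ x₀) (w u v : E) :
    fderiv ℝ γ x₀ w u v = fderiv ℝ (fun x => γ x u v) x₀ w := by
  have h1 := (hγ.hasFDerivAt.clm_apply (hasFDerivAt_const u x₀)).clm_apply
    (hasFDerivAt_const v x₀)
  rw [h1.fderiv]
  simp

/-- As `L_f f = 0`, contracting `L_f γ` with `f` gives `L_f (γ(f, ·)) = L_f a`, which vanishes by
`lie_covector_eq_zero`. -/
theorem lieBilin_reeb_left (hf : DifferentiableAt ℝ f x₀) (ha : DifferentiableAt ℝ a x₀)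
    (hγ : DifferentiableAt ℝ γ x₀) (hγf : ∀ᶠ x in 𝓝 x₀, γ x (f x) = a x)
    (h1 : ∀ᶠ x in 𝓝 x₀, a x (f x) = 1)
    (hd : ∀ v, fderiv ℝ a x₀ (f x₀) v - fderiv ℝ a x₀ v (f x₀) = 0) (v : E) :
    lieBilin f γ x₀ (f x₀) v = 0 := by
  have h2 := hγ.hasFDerivAt.clm_apply hf.hasFDerivAt
  have h3 := h2.unique (ha.hasFDerivAt.congr_of_eventuallyEq hγf)
  have h4 := DFunLike.congr_fun (DFunLike.congr_fun h3 (f x₀)) v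
  simp at h4
  rw [lieBilin_apply, hγf.self_of_nhds]
  linarith [lie_covector_eq_zero hf ha h1 hd v]

theorem lieBilin_symm (hγ : DifferentiableAt ℝ γ x₀)
    (hs : ∀ᶠ x in 𝓝 x₀, ∀ u v, γ x u v = γ x v u) (u v : E) :
    lieBilin f γ x₀ u v = lieBilin f γ x₀ v u := by
  have h1 : fderiv ℝ γ x₀ (f x₀) u v = fderiv ℝ γ x₀ (f x₀) v u := by
    rw [fderiv_bilin_apply hγ, fderiv_bilin_apply hγ]
    congr 1
    exact Filter.EventuallyEq.fderiv_eq (hs.mono fun x hx => hx u v)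
  rw [lieBilin_apply, lieBilin_apply, h1, hs.self_of_nhds (fderiv ℝ f x₀ u) v,
    hs.self_of_nhds u (fderiv ℝ f x₀ v)]
  ring

/-- Leibniz rule for `a ⊗ a`, with `L_f a = 0`. -/
theorem lieBilin_square (hf : DifferentiableAt ℝ f x₀) (ha : DifferentiableAt ℝ a x₀)
    (hγ : DifferentiableAt ℝ γ x₀) (hγa : ∀ᶠ x in 𝓝 x₀, ∀ u v, γ x u v = a x u * a x v)
    (h1 : ∀ᶠ x in 𝓝 x₀, a x (f x) = 1)
    (hd : ∀ v, fderiv ℝ a x₀ (f x₀) v - fderiv ℝ a x₀ v (f x₀) = 0) (u v : E) :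
    lieBilin f γ x₀ u v = 0 := by
  have h2 : fderiv ℝ γ x₀ (f x₀) u v =
      fderiv ℝ a x₀ (f x₀) u * a x₀ v + a x₀ u * fderiv ℝ a x₀ (f x₀) v := by
    rw [fderiv_bilin_apply hγ, Filter.EventuallyEq.fderiv_eq (hγa.mono fun x hx => hx u v)]
    have hu := ha.hasFDerivAt.clm_apply (hasFDerivAt_const u x₀)
    have hv := ha.hasFDerivAt.clm_apply (hasFDerivAt_const v x₀)
    refine (DFunLike.congr_fun (hu.mul hv).fderiv (f x₀)).trans ?_
    simp
    ring
  have hu := lie_covector_eq_zero hf ha h1 hd u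
  have hv := lie_covector_eq_zero hf ha h1 hd v
  rw [lieBilin_apply, h2, hγa.self_of_nhds, hγa.self_of_nhds]
  linear_combination a x₀ v * hu + a x₀ u * hv

theorem differentiableAt_inverse {F : Type*} [NormedAddCommGroup F] [NormedSpace ℝ F]
    [CompleteSpace E] {A : E → E →L[ℝ] F} (hA : DifferentiableAt ℝ A x₀) {e : E ≃L[ℝ] F}
    (he : (e : E →L[ℝ] F) = A x₀) : DifferentiableAt ℝ (fun x => (A x).inverse) x₀ := by
  have h1 : DifferentiableAt ℝ (ContinuousLinearMap.inverse (R := ℝ) (M := E) (M₂ := F)) (A x₀) := by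
    rw [← he]
    exact (contDiffAt_map_inverse (n := 1) e).differentiableAt (by simp)
  exact h1.comp x₀ hA

/-- The Poisson bracket of the geodesic Hamiltonian with a linear one is half the Lie derivative of
the metric. -/
theorem bracket_eq_lieBilin {Γ : E → (E →L[ℝ] ℝ) →L[ℝ] E} (hf : DifferentiableAt ℝ f x₀)
    (hγ : DifferentiableAt ℝ γ x₀) (hΓ : DifferentiableAt ℝ Γ x₀)
    (hs : ∀ u v, γ x₀ u v = γ x₀ v u) (hγΓ : ∀ᶠ x in 𝓝 x₀, ∀ p, γ x (Γ x p) = p)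
    {h k : E → (E →L[ℝ] ℝ) → ℝ}
    (hh : ∀ᶠ x in 𝓝 x₀, ∀ p, h x p = (1 / 2) * (p (Γ x p) - p (f x) * p (f x)))
    (hk : ∀ᶠ x in 𝓝 x₀, ∀ p, k x p = p (f x)) (p : E →L[ℝ] ℝ) :
    fderiv ℝ (fun p' => h x₀ p') p (fderiv ℝ (fun x => k x p) x₀) -
      fderiv ℝ (fun p' => k x₀ p') p (fderiv ℝ (fun x => h x p) x₀) =
      (1 / 2) * lieBilin f γ x₀ (Γ x₀ p) (Γ x₀ p) := by
  have e : ∀ p u, γ x₀ (Γ x₀ p) u = p u := fun p u => by rw [hγΓ.self_of_nhds]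
  -- the partial differentials
  have hkx : fderiv ℝ (fun x => k x p) x₀ = p.comp (fderiv ℝ f x₀) := by
    rw [Filter.EventuallyEq.fderiv_eq (hk.mono fun x hx => hx p)]
    exact (p.hasFDerivAt.comp x₀ hf.hasFDerivAt).fderiv
  have hkp : ∀ δ, fderiv ℝ (fun p' => k x₀ p') p δ = δ (f x₀) := by
    intro δ
    rw [show (fun p' => k x₀ p') = fun p' => p' (f x₀) from funext hk.self_of_nhds]
    have := (hasFDerivAt_id p).clm_apply (hasFDerivAt_const (f x₀) p)
    exact (DFunLike.congr_fun this.fderiv δ).trans (by simp)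
  have hhp : ∀ δ : E →L[ℝ] ℝ, fderiv ℝ (fun p' => h x₀ p') p δ =
      δ (Γ x₀ p) - p (f x₀) * δ (f x₀) := by
    intro δ
    rw [show (fun p' => h x₀ p') =
      fun p' => (1 / 2) * (p' (Γ x₀ p') - p' (f x₀) * p' (f x₀)) from funext hh.self_of_nhds]
    have h1 := (hasFDerivAt_id p).clm_apply (hasFDerivAt_const (f x₀) p)
    have h2 := (hasFDerivAt_id p).clm_apply (Γ x₀).hasFDerivAt
    have h3 := (h2.sub (h1.mul h1)).const_mul (1 / 2)
    have h4 : p (Γ x₀ δ) = δ (Γ x₀ p) := by rw [← e p, hs, e]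
    refine (DFunLike.congr_fun h3.fderiv δ).trans ?_
    simp [h4]
    ring
  have hc := hΓ.hasFDerivAt.clm_apply (hasFDerivAt_const p x₀)
  have hhx : fderiv ℝ (fun x => h x p) x₀ (f x₀) =
      (1 / 2) * p (fderiv ℝ Γ x₀ (f x₀) p) - p (f x₀) * p (fderiv ℝ f x₀ (f x₀)) := by
    rw [Filter.EventuallyEq.fderiv_eq (hh.mono fun x hx => hx p)]
    have h1 := p.hasFDerivAt.comp x₀ hf.hasFDerivAt
    have h2 := p.hasFDerivAt.comp x₀ hc
    have h3 := (h2.sub (h1.mul h1)).const_mul (1 / 2)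
    refine (DFunLike.congr_fun h3.fderiv (f x₀)).trans ?_
    simp
    ring
  -- differentiate `γ (Γ p) = p`
  have hinv : fderiv ℝ γ x₀ (f x₀) (Γ x₀ p) (Γ x₀ p) + p (fderiv ℝ Γ x₀ (f x₀) p) = 0 := by
    have h1 := (hγ.hasFDerivAt.clm_apply hc).unique
      ((hasFDerivAt_const p x₀).congr_of_eventuallyEq (hγΓ.mono fun x hx => hx p))
    have h2 := DFunLike.congr_fun (DFunLike.congr_fun h1 (f x₀)) (Γ x₀ p)
    simp at h2
    rw [hs, e] at h2
    linarith
  -- The terms from `(p f)²` cancel in the bracket, and `hinv` trades the derivative of `Γ` for that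
  -- of `γ`.
  rw [hkx, hkp, hhp, hhx, lieBilin_apply, hs (fderiv ℝ f x₀ (Γ x₀ p)), e]
  simp only [ContinuousLinearMap.comp_apply]
  linarith

end Coordinates

/-! ### The extended metric and its inverse -/

namespace ContactStructure

/-- `α` is a smooth 1-form with kernel `H` and Reeb vector field `X₀`. -/
structure IsReebPair [IsManifold (𝓡 3) ∞ M] (L : ContactStructure M) (α : OneForm M) (X₀ : VField M) : Prop where
  smooth_form : α.SmoothOn Set.univ
  smooth_field : X₀.SmoothOn Set.univ
  mem_iff : ∀ q v, v ∈ L.H q ↔ α q v = 0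
  form_field : ∀ q, α q (X₀ q) = 1
  d_eq_zero : ∀ q v, α.d q (X₀ q) v = 0

end ContactStructure


/-- The square of a 1-form. -/
def OneForm.square (α : OneForm M) (q : M) : LinearMap.BilinForm ℝ (TangentSpace (𝓡 3) q) :=
  (LinearMap.mul ℝ ℝ).compl₁₂ (α q).toLinearMap (α q).toLinearMap

theorem OneForm.square_apply (α : OneForm M) (q : M) (u v : TangentSpace (𝓡 3) q) :
    α.square q u v = α q u * α q v := rfl

theorem OneForm.inChart_apply [IsManifold (𝓡 3) ∞ M] (α : OneForm M) {q : M} {x : E3}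
    (hx : x ∈ (extChartAt (𝓡 3) q).target) (u : E3) :
    α.inChart q x u = α ((extChartAt (𝓡 3) q).symm x) (chartInv q _ u) := by
  rw [chartInv_symm hx]
  rfl

theorem OneForm.inChart_chart [IsManifold (𝓡 3) ∞ M] (α : OneForm M)
    {q p : M} (hp : p ∈ (extChartAt (𝓡 3) q).source)
    (u : E3) : α.inChart q (extChartAt (𝓡 3) q p) u = α p (chartInv q p u) := by
  rw [α.inChart_apply ((extChartAt (𝓡 3) q).map_source hp), (extChartAt (𝓡 3) q).left_inv hp]

theorem contDiffOn_bilinInChart [IsManifold (𝓡 3) ∞ M] 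
    {b : ∀ q : M, LinearMap.BilinForm ℝ (TangentSpace (𝓡 3) q)} {q : M}
    (h : ∀ u v : E3, ContMDiffOn (𝓡 3) 𝓘(ℝ, ℝ) ∞ (fun p => b p (chartInv q p u) (chartInv q p v))
      (extChartAt (𝓡 3) q).source) :
    ContDiffOn ℝ ∞ (bilinInChart b q) (extChartAt (𝓡 3) q).target := by
  rw [contDiffOn_clm_apply]
  intro u
  rw [contDiffOn_clm_apply]
  intro v
  exact ((h u v).comp (contMDiffOn_extChartAt_symm q)
    (fun x hx => (extChartAt (𝓡 3) q).map_target hx)).contDiffOn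

theorem chart_target_mem_nhds (q : M) :
    (extChartAt (𝓡 3) q).target ∈ 𝓝 (extChartAt (𝓡 3) q q) :=
  extChartAt_target_mem_nhds q

namespace ContactStructure

variable [IsManifold (𝓡 3) ∞ M]

theorem eq_zero_of_g_eq_zero (L : ContactStructure M) {q : M} {v : L.H q}
    (h : ∀ w, L.g q v w = 0) : v = 0 :=
  (L.g_nondegenerate q).1 v h

theorem g_G (L : ContactStructure M) (q : M) (lam : Cotangent q) (w : L.H q) :
    L.g q (L.G q lam) w = lam w := by
  have := LinearMap.BilinForm.apply_toDual_symm_apply (B := L.g q) (hB := L.g_nondegenerate q)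
    ((lam : TangentSpace (𝓡 3) q →ₗ[ℝ] ℝ).domRestrict (L.H q)) w
  exact this

namespace IsReebPair

variable {L : ContactStructure M} {α : OneForm M} {X₀ : VField M} (h : L.IsReebPair α X₀)
include h

theorem contMDiffOn_form (q : M) (u : E3) :
    ContMDiffOn (𝓡 3) 𝓘(ℝ, ℝ) ∞ (fun p => α p (chartInv q p u)) (extChartAt (𝓡 3) q).source := by
  have h1 : ContDiffOn ℝ ∞ (fun x => α.inChart q x u) (extChartAt (𝓡 3) q).target :=
    ((h.smooth_form q).mono fun x hx => ⟨hx, trivial⟩).clm_apply contDiffOn_const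
  have h2 := h1.contMDiffOn.comp (contMDiffOn_extChartAt (n := ∞) (x := q) (I := 𝓡 3))
    (fun p hp => (extChartAt (𝓡 3) q).map_source (by rwa [extChartAt_source]))
  rw [← extChartAt_source (I := 𝓡 3)] at h2
  exact h2.congr fun p hp => (α.inChart_chart hp u).symm

theorem differentiableAt_form (q : M) :
    DifferentiableAt ℝ (α.inChart q) (extChartAt (𝓡 3) q q) :=
  (((h.smooth_form q).mono fun _ hx => ⟨hx, trivial⟩).contDiffAt
    (chart_target_mem_nhds q)).differentiableAt (by simp)

theorem differentiableAt_field (q : M) :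
    DifferentiableAt ℝ (X₀.inChart q) (extChartAt (𝓡 3) q q) :=
  (((h.smooth_field.contDiffOn_inChart isOpen_univ q).mono fun _ hx => ⟨hx, trivial⟩).contDiffAt
    (chart_target_mem_nhds q)).differentiableAt (by simp)

theorem differentiableAt_square (q : M) :
    DifferentiableAt ℝ (bilinInChart α.square q) (extChartAt (𝓡 3) q q) :=
  ((contDiffOn_bilinInChart fun u v => (h.contMDiffOn_form q u).mul
    (h.contMDiffOn_form q v)).contDiffAt (chart_target_mem_nhds q)).differentiableAt (by simp)

theorem inChart_form_field {q : M} {x : E3} (hx : x ∈ (extChartAt (𝓡 3) q).target) :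
    α.inChart q x (X₀.inChart q x) = 1 := by
  rw [α.inChart_apply hx, VField.inChart,
    chartInv_chartD ((extChartAt (𝓡 3) q).map_target hx), h.form_field]

theorem inChart_d (q : M) (v : E3) :
    fderiv ℝ (α.inChart q) (extChartAt (𝓡 3) q q) (X₀.inChart q (extChartAt (𝓡 3) q q)) v -
      fderiv ℝ (α.inChart q) (extChartAt (𝓡 3) q q) v (X₀.inChart q (extChartAt (𝓡 3) q q)) = 0 := by
  have hq := mem_extChartAt_source (I := 𝓡 3) q
  have h1 := h.d_eq_zero q (chartInv q q v)
  rw [X₀.inChart_chart hq]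
  conv_lhs => rw [← chartD_chartInv hq v]
  exact h1

theorem lieAt_square (q : M) (u v : TangentSpace (𝓡 3) q) : lieAt X₀ α.square q u v = 0 := by
  refine lieBilin_square (h.differentiableAt_field q) (h.differentiableAt_form q)
    (h.differentiableAt_square q) ?_ ?_ (h.inChart_d q) _ _
  · filter_upwards [chart_target_mem_nhds q] with x hx u v
    rw [α.inChart_apply hx, α.inChart_apply hx]
    rfl
  · filter_upwards [chart_target_mem_nhds q] with x hx using h.inChart_form_field hx

/-- The projection on the distribution along the Reeb field. -/
def proj (q : M) : TangentSpace (𝓡 3) q →ₗ[ℝ] L.H q :=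
  LinearMap.codRestrict (L.H q) (LinearMap.id - (α q).toLinearMap.smulRight (X₀ q)) (fun v => by
    rw [h.mem_iff]
    simp [h.form_field])

theorem coe_proj (q : M) (v : TangentSpace (𝓡 3) q) :
    (h.proj q v : TangentSpace (𝓡 3) q) = v - α q v • X₀ q := rfl

theorem proj_coe (q : M) (v : L.H q) : h.proj q v = v := by
  ext
  rw [h.coe_proj, (h.mem_iff q v).1 v.2, zero_smul, sub_zero]

theorem proj_field (q : M) : h.proj q (X₀ q) = 0 := by
  ext
  rw [h.coe_proj, h.form_field, one_smul, sub_self]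
  rfl

/-- The metric that extends `g`, such that the Reeb field is a unit normal to the distribution. -/
def metric (q : M) : LinearMap.BilinForm ℝ (TangentSpace (𝓡 3) q) :=
  (L.g q).compl₁₂ (h.proj q) (h.proj q) + α.square q

theorem metric_apply (q : M) (u v : TangentSpace (𝓡 3) q) :
    h.metric q u v = L.g q (h.proj q u) (h.proj q v) + α q u * α q v := rfl

theorem metric_symm (q : M) (u v : TangentSpace (𝓡 3) q) :
    h.metric q u v = h.metric q v u := by
  rw [h.metric_apply, h.metric_apply, L.g_symm, mul_comm]

theorem metric_field (q : M) (v : TangentSpace (𝓡 3) q) : h.metric q (X₀ q) v = α q v := by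
  rw [h.metric_apply, h.proj_field, h.form_field, map_zero, LinearMap.zero_apply, zero_add, one_mul]

theorem metric_coe_left (q : M) (u : L.H q) (v : TangentSpace (𝓡 3) q) :
    h.metric q u v = L.g q u (h.proj q v) := by
  rw [h.metric_apply, h.proj_coe, (h.mem_iff q u).1 u.2, zero_mul, add_zero]

theorem metric_coe (q : M) (u v : L.H q) : h.metric q u v = L.g q u v := by
  rw [h.metric_coe_left, h.proj_coe]

/-- Orthogonality to `X₀` makes `u` horizontal; nondegeneracy of `g` does the rest. -/
theorem metric_nondegenerate {q : M} {u : TangentSpace (𝓡 3) q} (hu : ∀ v, h.metric q u v = 0) :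
    u = 0 := by
  have h1 : u ∈ L.H q := by
    rw [h.mem_iff, ← h.metric_field, h.metric_symm]
    exact hu _
  have h2 : (⟨u, h1⟩ : L.H q) = 0 := L.eq_zero_of_g_eq_zero fun w => by
    rw [← h.metric_coe]
    exact hu w
  exact congrArg Subtype.val h2

/-- Smoothness of `g` is only given on horizontal fields, so it is tested on the projections of the
coordinate fields. -/
theorem contDiffOn_metric (q : M) :
    ContDiffOn ℝ ∞ (bilinInChart h.metric q) (extChartAt (𝓡 3) q).target := by
  have hsm : ∀ u : E3, VField.SmoothOn
      (fun p => (h.proj p (chartInv q p u) : TangentSpace (𝓡 3) p))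
      (extChartAt (𝓡 3) q).source := fun u =>
    ContMDiffOn.sub_section (smoothOn_chartInv q u)
      (ContMDiffOn.smul_section (h.contMDiffOn_form q u)
        (ContMDiffOn.mono h.smooth_field (Set.subset_univ _)))
  refine contDiffOn_bilinInChart fun u v => ?_
  exact (L.g_smooth _ (isOpen_extChartAt_source q) (fun p => h.proj p (chartInv q p u))
    (fun p => h.proj p (chartInv q p v)) (hsm u) (hsm v)).add
    ((h.contMDiffOn_form q u).mul (h.contMDiffOn_form q v))

theorem differentiableAt_metric (q : M) :
    DifferentiableAt ℝ (bilinInChart h.metric q) (extChartAt (𝓡 3) q q) :=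
  ((h.contDiffOn_metric q).contDiffAt (chart_target_mem_nhds q)).differentiableAt (by simp)

theorem bilinInChart_metric_field {q : M} {x : E3} (hx : x ∈ (extChartAt (𝓡 3) q).target) :
    bilinInChart h.metric q x (X₀.inChart q x) = α.inChart q x := by
  ext v
  rw [bilinInChart_apply, VField.inChart,
    chartInv_chartD ((extChartAt (𝓡 3) q).map_target hx), h.metric_field, α.inChart_apply hx]

theorem bilinInChart_metric_symm (q : M) (x u v : E3) :
    bilinInChart h.metric q x u v = bilinInChart h.metric q x v u := by
  rw [bilinInChart_apply, bilinInChart_apply, h.metric_symm]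

/-- This is why the bracket form descends modulo the annihilator of `H`, and why only the
restriction of the Lie derivative to `H` matters. -/
theorem lieAt_metric_field (q : M) (v : TangentSpace (𝓡 3) q) :
    lieAt X₀ h.metric q (X₀ q) v = 0 := by
  rw [lieAt, ← X₀.inChart_chart (mem_extChartAt_source q)]
  refine lieBilin_reeb_left (h.differentiableAt_field q) (h.differentiableAt_form q)
    (h.differentiableAt_metric q) ?_ ?_ (h.inChart_d q) _
  · filter_upwards [chart_target_mem_nhds q] with x hx using h.bilinInChart_metric_field hx
  · filter_upwards [chart_target_mem_nhds q] with x hx using h.inChart_form_field hx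

theorem lieAt_metric_symm (q : M) (u v : TangentSpace (𝓡 3) q) :
    lieAt X₀ h.metric q u v = lieAt X₀ h.metric q v u :=
  lieBilin_symm (h.differentiableAt_metric q)
    (Filter.Eventually.of_forall fun x => h.bilinInChart_metric_symm q x) _ _

/-- The inverse of the extended metric, in the chart around `q`. -/
def inverseMetric (q : M) (x : E3) : (E3 →L[ℝ] ℝ) →L[ℝ] E3 := (bilinInChart h.metric q x).inverse

theorem exists_equiv_metric {q : M} {x : E3} (hx : x ∈ (extChartAt (𝓡 3) q).target) :
    ∃ e : E3 ≃L[ℝ] (E3 →L[ℝ] ℝ), (e : E3 →L[ℝ] E3 →L[ℝ] ℝ) = bilinInChart h.metric q x := by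
  have hs := (extChartAt (𝓡 3) q).map_target hx
  have hinj : Function.Injective (bilinInChart h.metric q x).toLinearMap := by
    rw [injective_iff_map_eq_zero]
    intro u hu
    have h1 : chartInv q ((extChartAt (𝓡 3) q).symm x) u = 0 := h.metric_nondegenerate fun v => by
      rw [← chartInv_chartD hs v, ← bilinInChart_apply]
      exact DFunLike.congr_fun hu _
    rw [← chartD_chartInv hs u, h1, map_zero]
  have hfin : Module.finrank ℝ E3 = Module.finrank ℝ (E3 →L[ℝ] ℝ) := by
    rw [← LinearEquiv.finrank_eq (LinearMap.toContinuousLinearMap (𝕜 := ℝ) (E := E3) (F' := ℝ))]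
    exact Subspace.dual_finrank_eq.symm
  refine ⟨(LinearEquiv.ofInjectiveOfFinrankEq _ hinj hfin).toContinuousLinearEquiv, ?_⟩
  ext u v
  rfl

theorem metric_inverseMetric {q : M} {x : E3} (hx : x ∈ (extChartAt (𝓡 3) q).target)
    (p : E3 →L[ℝ] ℝ) : bilinInChart h.metric q x (h.inverseMetric q x p) = p := by
  obtain ⟨e, he⟩ := h.exists_equiv_metric hx
  rw [inverseMetric, ← he, ContinuousLinearMap.inverse_equiv]
  exact e.apply_symm_apply p

theorem inverseMetric_metric {q : M} {x : E3} (hx : x ∈ (extChartAt (𝓡 3) q).target) (u : E3) :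
    h.inverseMetric q x (bilinInChart h.metric q x u) = u := by
  obtain ⟨e, he⟩ := h.exists_equiv_metric hx
  rw [inverseMetric, ← he, ContinuousLinearMap.inverse_equiv]
  exact e.symm_apply_apply u

theorem differentiableAt_inverseMetric (q : M) :
    DifferentiableAt ℝ (h.inverseMetric q) (extChartAt (𝓡 3) q q) := by
  obtain ⟨e, he⟩ := h.exists_equiv_metric ((extChartAt (𝓡 3) q).map_source (mem_extChartAt_source q))
  exact differentiableAt_inverse (F := E3 →L[ℝ] ℝ) (h.differentiableAt_metric q) he

/-- The inverse metric is the sum of the cometric and the square of the Reeb field. -/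
theorem inverseMetric_eq {q p : M} (hp : p ∈ (extChartAt (𝓡 3) q).source) (lam : Cotangent p) :
    h.inverseMetric q (extChartAt (𝓡 3) q p) (lam.comp (chartInv q p)) =
      chartD q p (L.G p lam) + lam (X₀ p) • chartD q p (X₀ p) := by
  have hx := (extChartAt (𝓡 3) q).map_source hp
  -- Applying the metric to the candidate gives `λ(πu) + λ(X₀) α(u) = λ(u)`.
  have h1 : bilinInChart h.metric q (extChartAt (𝓡 3) q p)
      (chartD q p (L.G p lam) + lam (X₀ p) • chartD q p (X₀ p)) = lam.comp (chartInv q p) := by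
    ext u
    rw [map_add, map_smul, add_apply, smul_apply,
      bilinInChart_chart _ hp, bilinInChart_chart _ hp, chartInv_chartD hp, chartInv_chartD hp,
      h.metric_field, h.metric_coe_left, g_G, h.coe_proj, map_sub, map_smul,
      ContinuousLinearMap.comp_apply]
    simp only [smul_eq_mul]
    ring
  rw [← h1, h.inverseMetric_metric hx]

end IsReebPair

end ContactStructure

/-! ### The bracket form as half the Lie derivative of the metric -/

theorem lieAt_add_smul_left (X Y : VField M)
    (b : ∀ q : M, LinearMap.BilinForm ℝ (TangentSpace (𝓡 3) q)) (q : M)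
    (u v : TangentSpace (𝓡 3) q) (c : ℝ) :
    lieAt X b q (u + c • Y q) v = lieAt X b q u v + c * lieAt X b q (Y q) v := by
  simp only [lieAt, map_add, map_smul, add_apply,
    smul_apply, smul_eq_mul]

namespace ContactStructure.IsReebPair

variable [IsManifold (𝓡 3) ∞ M] {L : ContactStructure M} {α : OneForm M} {X₀ : VField M}
  (h : L.IsReebPair α X₀)
include h

theorem lieAt_metric_add (q : M) (u v : TangentSpace (𝓡 3) q) (c d : ℝ) :
    lieAt X₀ h.metric q (u + c • X₀ q) (v + d • X₀ q) = lieAt X₀ h.metric q u v := by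
  rw [lieAt_add_smul_left, h.lieAt_metric_field, h.lieAt_metric_symm, lieAt_add_smul_left,
    h.lieAt_metric_field, h.lieAt_metric_symm]
  ring

/-- By `inverseMetric_eq`, removing the square of `h₀` from the inverse metric leaves the cometric
`G`. -/
theorem cotCoord_geodesicHamiltonian {q : M} {x : E3} (hx : x ∈ (extChartAt (𝓡 3) q).target)
    (p : E3 →L[ℝ] ℝ) : cotCoord L.geodesicHamiltonian q x p =
      (1 / 2) * (p (h.inverseMetric q x p) - p (X₀.inChart q x) * p (X₀.inChart q x)) := by
  have hs := (extChartAt (𝓡 3) q).map_target hx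
  let lam : Cotangent ((extChartAt (𝓡 3) q).symm x) := p.comp (chartD q _)
  have h1 : lam.comp (chartInv q _) = p := by
    ext u
    exact congrArg p (chartD_chartInv hs u)
  have h2 := h.inverseMetric_eq hs lam
  rw [(extChartAt (𝓡 3) q).right_inv hx, h1] at h2
  rw [h2, map_add, map_smul, smul_eq_mul]
  change (1 / 2) * lam (L.G _ lam) = (1 / 2) * (lam (L.G _ lam) +
    lam (X₀ _) * lam (X₀ _) - lam (X₀ _) * lam (X₀ _))
  ring

theorem poissonBracket_eq (q : M) (p : E3 →L[ℝ] ℝ) :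
    poissonBracket L.geodesicHamiltonian (fun q' lam => lam (X₀ q')) q p =
      (1 / 2) * lieBilin (X₀.inChart q) (bilinInChart h.metric q) (extChartAt (𝓡 3) q q)
        (h.inverseMetric q (extChartAt (𝓡 3) q q) p)
        (h.inverseMetric q (extChartAt (𝓡 3) q q) p) := by
  refine bracket_eq_lieBilin (h := cotCoord L.geodesicHamiltonian q)
    (k := cotCoord (fun q' lam => lam (X₀ q')) q) (h.differentiableAt_field q)
    (h.differentiableAt_metric q) (h.differentiableAt_inverseMetric q)
    (h.bilinInChart_metric_symm q _) ?_ ?_ ?_ p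
  · filter_upwards [chart_target_mem_nhds q] with x hx p using h.metric_inverseMetric hx p
  · filter_upwards [chart_target_mem_nhds q] with x hx p using h.cotCoord_geodesicHamiltonian hx p
  · exact Filter.Eventually.of_forall fun x p => rfl

/-- The inverse metric sends `λ` to `Gλ + λ(X₀) X₀`, and the Reeb component lies in the kernel of
the Lie derivative. -/
theorem bracketForm_eq (q : M) (lam mu : Cotangent q) :
    L.bracketForm X₀ q lam mu = (1 / 2) * lieAt X₀ h.metric q (L.G q lam) (L.G q mu) := by
  have hq := mem_extChartAt_source (I := 𝓡 3) q
  let Γ := h.inverseMetric q (extChartAt (𝓡 3) q q)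
  let Λ := lieBilin (X₀.inChart q) (bilinInChart h.metric q) (extChartAt (𝓡 3) q q)
  have h1 : ∀ p, poissonBracket L.geodesicHamiltonian (fun q' lam => lam (X₀ q')) q p =
      ((1 / 2 : ℝ) • Λ.bilinearComp Γ Γ) p p := fun p => h.poissonBracket_eq q p
  have h2 : ∀ lam : Cotangent q, Γ (momentum q lam) =
      chartD q q (L.G q lam + lam (X₀ q) • X₀ q) := by
    intro lam
    rw [map_add, map_smul]
    exact h.inverseMetric_eq hq lam
  have h3 : ∀ lam mu : Cotangent q, ((1 / 2 : ℝ) • Λ.bilinearComp Γ Γ) (momentum q lam)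
      (momentum q mu) = (1 / 2) * lieAt X₀ h.metric q (L.G q lam) (L.G q mu) := by
    intro lam mu
    rw [← h.lieAt_metric_add q _ _ (lam (X₀ q)) (mu (X₀ q)), lieAt, ← h2, ← h2]
    rfl
  refine (polarization_eq h1 (momentum q lam) (momentum q mu)).trans ?_
  rw [h3, h3, h.lieAt_metric_symm q (L.G q mu)]
  ring

theorem hBar_eq (q : M) (v w : L.H q) :
    L.hBar X₀ q v w = (1 / 2) * lieAt X₀ h.metric q v w := by
  refine (h.bracketForm_eq q _ _).trans ?_
  rw [L.G_liftG, L.G_liftG]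

/-- The invariant tensor vanishes iff the Lie derivative of the metric along the Reeb field
vanishes on the distribution. -/
theorem hTilde_eq_zero_iff (q : M) :
    L.hTilde X₀ q = 0 ↔ ∀ v w : L.H q, lieAt X₀ h.metric q v w = 0 := by
  have h1 : L.hTilde X₀ q = 0 ↔ L.hBar X₀ q = 0 := by
    constructor
    · intro h0
      refine LinearMap.ext fun v => ?_
      exact (L.sharp q).map_eq_zero_iff.1 (LinearMap.congr_fun h0 v)
    · intro h0
      rw [hTilde, h0, LinearMap.comp_zero]
  rw [h1]
  constructor
  · intro h0 v w
    have := h.hBar_eq q v w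
    rw [h0] at this
    simpa using this.symm
  · intro h0
    ext v w
    rw [h.hBar_eq, h0]
    simp

theorem lieAt_metric_eq_zero {q : M} (h0 : ∀ v w : L.H q, lieAt X₀ h.metric q v w = 0)
    (v w : TangentSpace (𝓡 3) q) : lieAt X₀ h.metric q v w = 0 := by
  have hsplit : ∀ v : TangentSpace (𝓡 3) q, (h.proj q v : TangentSpace (𝓡 3) q) + α q v • X₀ q = v :=
    fun v => by rw [h.coe_proj, sub_add_cancel]
  rw [← hsplit v, ← hsplit w, h.lieAt_metric_add, h0]

end ContactStructure.IsReebPair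

/-! ### Tensors invariant under the flow -/

theorem IsLocalFlow.mfderiv_zero {X : VField M} {J : Set ℝ} {U : Set M} {ψ : ℝ → M → M}
    (hψ : IsLocalFlow X J U ψ) {p : M} (hp : p ∈ U) :
    (mfderiv (𝓡 3) (𝓡 3) (ψ 0) p : E3 →L[ℝ] E3) = ContinuousLinearMap.id ℝ E3 := by
  have h1 : ψ 0 =ᶠ[𝓝 p] id := by
    filter_upwards [hψ.open_U.mem_nhds hp] with p' hp' using hψ.initial p' hp'
  exact ((hasMFDerivAt_id p).congr_of_eventuallyEq h1).mfderiv

theorem IsLocalFlow.pullback_zero {X : VField M} {J : Set ℝ} {U : Set M} {ψ : ℝ → M → M}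
    (hψ : IsLocalFlow X J U ψ) {p : M} (hp : p ∈ U)
    (β : ∀ q : M, TangentSpace (𝓡 3) q → TangentSpace (𝓡 3) q → ℝ) (v w : TangentSpace (𝓡 3) p) :
    β (ψ 0 p) (mfderiv (𝓡 3) (𝓡 3) (ψ 0) p v) (mfderiv (𝓡 3) (𝓡 3) (ψ 0) p w) = β p v w := by
  have h1 : ∀ u : TangentSpace (𝓡 3) p, (mfderiv (𝓡 3) (𝓡 3) (ψ 0) p u : E3) = (u : E3) :=
    fun u => DFunLike.congr_fun (hψ.mfderiv_zero hp) u
  -- The tangent spaces at `ψ 0 p` and `p` are both `E3`, but the points are only propositionally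
  -- equal, so the point is generalized before substitution.
  have h2 : ∀ (q : M) (_ : q = p) (v' w' : E3), v' = (v : E3) → w' = (w : E3) →
      β q v' w' = β p v w := by
    rintro q rfl v' w' rfl rfl
    rfl
  exact h2 _ (hψ.initial p hp) _ _ (h1 v) (h1 w)

/-- A field of bilinear forms with vanishing Lie derivative is invariant under the flow. -/
theorem IsLocalFlow.pullback_eq [IsManifold (𝓡 3) ∞ M] {X : VField M}
    (hX : X.SmoothOn Set.univ) {J : Set ℝ} {U : Set M}
    {ψ : ℝ → M → M} (hψ : IsLocalFlow X J U ψ)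
    {b : ∀ q : M, LinearMap.BilinForm ℝ (TangentSpace (𝓡 3) q)}
    (hb : ∀ q, DifferentiableAt ℝ (bilinInChart b q) (extChartAt (𝓡 3) q q))
    (h0 : ∀ q u v, lieAt X b q u v = 0) {t : ℝ} (ht : t ∈ J) {p : M} (hp : p ∈ U)
    (v w : TangentSpace (𝓡 3) p) :
    b (ψ t p) (mfderiv (𝓡 3) (𝓡 3) (ψ t) p v) (mfderiv (𝓡 3) (𝓡 3) (ψ t) p w) = b p v w := by
  have hd : ∀ s ∈ J, HasDerivAt (fun s => b (ψ s p) (mfderiv (𝓡 3) (𝓡 3) (ψ s) p v)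
      (mfderiv (𝓡 3) (𝓡 3) (ψ s) p w)) 0 s := by
    intro s hs
    have := hψ.hasDerivAt_pullback hX hs hp (hb _) v w
    rwa [h0] at this
  have h1 := hψ.open_J.is_const_of_deriv_eq_zero hψ.interval_J.isPreconnected
    (fun s hs => (hd s hs).differentiableAt.differentiableWithinAt)
    (fun s hs => (hd s hs).deriv) ht hψ.zero_mem
  exact h1.trans (hψ.pullback_zero hp (fun q u v => b q u v) v w)

/-! ### Time maps of the flow as diffeomorphisms onto open sets -/

/-- The inverse function theorem for injective maps. -/
theorem exists_partialDiffeomorph [IsManifold (𝓡 3) ∞ M] {f : M → M} {U : Set M} (hU : IsOpen U)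
    (hf : ContMDiffOn (𝓡 3) (𝓡 3) ∞ f U) (hinj : Set.InjOn f U)
    (hd : ∀ p ∈ U, Function.Injective (mfderiv (𝓡 3) (𝓡 3) f p)) :
    ∃ Φ : PartialDiffeomorph (𝓡 3) (𝓡 3) M M ∞, Φ.source = U ∧ Set.EqOn f Φ U := by
  -- `Function.invFunOn` needs a default point.
  rcases isEmpty_or_nonempty M with hM | hM
  · exact ⟨⟨PartialEquiv.ofSet U, hU, hU, contMDiffOn_id, contMDiffOn_id⟩, rfl,
      fun p => isEmptyElim p⟩
  let g := Function.invFunOn f U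
  have hgf : ∀ p ∈ U, g (f p) = p := fun p hp => hinj.leftInvOn_invFunOn hp
  have key : ∀ p ∈ U, f '' U ∈ 𝓝 (f p) ∧ ContMDiffAt (𝓡 3) (𝓡 3) ∞ g (f p) := by
    intro p hp
    let χ := extChartAt (𝓡 3) p
    let φ := extChartAt (𝓡 3) (f p)
    have hpχ : p ∈ χ.source := mem_extChartAt_source p
    have hpφ : f p ∈ φ.source := mem_extChartAt_source (f p)
    have hxt := χ.map_source hpχ
    have hχp : χ.symm (χ p) = p := χ.left_inv hpχ
    have hfp : ContMDiffAt (𝓡 3) (𝓡 3) ∞ f p := hf.contMDiffAt (hU.mem_nhds hp)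
    let F : E3 → E3 := fun x => φ (f (χ.symm x))
    have hsymm : ContMDiffAt 𝓘(ℝ, E3) (𝓡 3) ∞ χ.symm (χ p) := contMDiffAt_symm hxt
    have hfs : ContMDiffAt 𝓘(ℝ, E3) (𝓡 3) ∞ (fun x => f (χ.symm x)) (χ p) :=
      ContMDiffAt.comp (χ p) (by rwa [hχp]) hsymm
    have hF : ContDiffAt ℝ ∞ F (χ p) :=
      (ContMDiffAt.comp (χ p) (contMDiffAt_chart (by rwa [hχp])) hfs).contDiffAt
    have hF' := (hF.differentiableAt (by simp)).hasFDerivAt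
    -- the derivative of `F` is injective
    have hFd : ∀ v : TangentSpace (𝓡 3) p, fderiv ℝ F (χ p) (chartD p p v) =
        chartD (f p) (f p) (mfderiv (𝓡 3) (𝓡 3) f p v) := by
      intro v
      have h2 := hF'.hasMFDerivAt.comp p
        ((contMDiffAt_chart hpχ).mdifferentiableAt (by simp)).hasMFDerivAt
      have h3 := ((contMDiffAt_chart hpφ).mdifferentiableAt (by simp)).hasMFDerivAt.comp p
        (hfp.mdifferentiableAt (by simp)).hasMFDerivAt
      have h4 : (φ ∘ f) =ᶠ[𝓝 p] (F ∘ χ) := by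
        filter_upwards [(isOpen_extChartAt_source p).mem_nhds hpχ] with p' hp'
        change φ (f p') = φ (f (χ.symm (χ p')))
        rw [χ.left_inv hp']
      exact (DFunLike.congr_fun (hasMFDerivAt_unique (h3.congr_of_eventuallyEq h4.symm) h2) v).symm
    have hinjF : Function.Injective (fderiv ℝ F (χ p)).toLinearMap := by
      rw [injective_iff_map_eq_zero]
      intro u hu
      have hu' : fderiv ℝ F (χ p) u = 0 := hu
      rw [← chartD_chartInv hpχ u, hFd] at hu'
      have h1 : mfderiv (𝓡 3) (𝓡 3) f p (chartInv p p u) = 0 := by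
        rw [← chartInv_chartD hpφ (mfderiv (𝓡 3) (𝓡 3) f p (chartInv p p u)), hu', map_zero]
      have h2 : chartInv p p u = 0 := hd p hp (h1.trans (map_zero _).symm)
      rw [← chartD_chartInv hpχ u, h2, map_zero]
    let e' : E3 ≃L[ℝ] E3 := (LinearEquiv.ofInjectiveEndo _ hinjF).toContinuousLinearEquiv
    have he' : HasFDerivAt F (e' : E3 →L[ℝ] E3) (χ p) := hF'.congr_fderiv (by ext u; rfl)
    let e := hF.toOpenPartialHomeomorph F he' (by simp)
    have hcoe : ⇑e = F := ContDiffAt.toOpenPartialHomeomorph_coe _ he' (by simp)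
    have hes : χ p ∈ e.source := ContDiffAt.mem_toOpenPartialHomeomorph_source _ he' (by simp)
    have hFp : F (χ p) = φ (f p) := by
      change φ (f (χ.symm (χ p))) = _
      rw [hχp]
    have het : φ (f p) ∈ e.target := by
      rw [← hFp, ← hcoe]
      exact e.map_source hes
    have hesymm : e.symm (φ (f p)) = χ p := by
      rw [← hFp, ← hcoe]
      exact e.left_inv hes
    have hsm : ContDiffAt ℝ ∞ e.symm (φ (f p)) := by
      refine e.contDiffAt_symm (f₀' := e') het ?_ ?_
      · rw [hcoe, hesymm]
        exact he'
      · rw [hcoe, hesymm]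
        exact hF
    let g' : M → M := fun y => χ.symm (e.symm (φ y))
    have hφsm : ContMDiffAt (𝓡 3) 𝓘(ℝ, E3) ∞ φ (f p) := contMDiffAt_chart hpφ
    have h1 : ContMDiffAt (𝓡 3) 𝓘(ℝ, E3) ∞ (fun y => e.symm (φ y)) (f p) :=
      ContMDiffAt.comp (f p) hsm.contMDiffAt hφsm
    have hg' : ContMDiffAt (𝓡 3) (𝓡 3) ∞ g' (f p) :=
      ContMDiffAt.comp (f p) (by rw [hesymm]; exact hsymm) h1
    have hg'p : g' (f p) = p := by
      change χ.symm (e.symm (φ (f p))) = p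
      rw [hesymm, hχp]
    have hfg' : ContinuousAt (fun y => f (g' y)) (f p) :=
      ContinuousAt.comp (g := f) (by rw [hg'p]; exact hfp.continuousAt) hg'.continuousAt
    have hev : ∀ᶠ y in 𝓝 (f p), g' y ∈ U ∧ f (g' y) = y := by
      filter_upwards [hg'.continuousAt.eventually_mem (hU.mem_nhds (by rwa [hg'p])),
        hfg'.eventually_mem ((isOpen_extChartAt_source (I := 𝓡 3) (f p)).mem_nhds (by
          rw [hg'p]; exact hpφ)),
        (isOpen_extChartAt_source (I := 𝓡 3) (f p)).mem_nhds hpφ,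
        hφsm.continuousAt.eventually_mem (e.open_target.mem_nhds het)] with y hyU hfy hy hye
      refine ⟨hyU, φ.injOn hfy hy ?_⟩
      have := e.right_inv hye
      rwa [hcoe] at this
    -- The smooth local inverse `g'` takes values in `U`, so injectivity of `f` on `U` forces it to
    -- agree with `g` near `f p`.
    refine ⟨Filter.mem_of_superset hev fun y hy => ⟨g' y, hy⟩, hg'.congr_of_eventuallyEq ?_⟩
    filter_upwards [hev] with y hy
    conv_lhs => rw [← hy.2]
    exact hgf _ hy.1
  refine ⟨⟨⟨f, g, U, f '' U, fun p hp => ⟨p, hp, rfl⟩, ?_, hgf, ?_⟩, hU, ?_, hf, ?_⟩, rfl,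
    fun _ _ => rfl⟩
  · rintro _ ⟨p, hp, rfl⟩
    rwa [hgf p hp]
  · rintro _ ⟨p, hp, rfl⟩
    rw [hgf p hp]
  · rw [isOpen_iff_mem_nhds]
    rintro _ ⟨p, hp, rfl⟩
    exact (key p hp).1
  · rintro _ ⟨p, hp, rfl⟩
    exact (key p hp).2.contMDiffWithinAt

/-- Integral curves that meet at time `t` coincide back to time `0`; this uniqueness relies on `M`
being Hausdorff. -/
theorem IsLocalFlow.injOn [IsManifold (𝓡 3) ∞ M] [T2Space M] {X : VField M}
    (hX : X.SmoothOn Set.univ) {J : Set ℝ}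
    {U : Set M} {ψ : ℝ → M → M} (hψ : IsLocalFlow X J U ψ) {t : ℝ} (ht : t ∈ J) :
    Set.InjOn (ψ t) U := by
  intro p hp p' hp' heq
  -- The uniqueness theorem is applied on a bounded open interval, so the segment from `0` to `t` is
  -- enlarged slightly inside `J`.
  obtain ⟨a, b, h0, htab, hab⟩ : ∃ a b, (0 : ℝ) ∈ Set.Ioo a b ∧ t ∈ Set.Ioo a b ∧
      Set.Ioo a b ⊆ J := by
    have hmin : min 0 t ∈ J := by rcases min_choice 0 t with h | h <;> rw [h]; exacts [hψ.zero_mem, ht]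
    have hmax : max 0 t ∈ J := by rcases max_choice 0 t with h | h <;> rw [h]; exacts [hψ.zero_mem, ht]
    obtain ⟨l, hl, hlJ⟩ := exists_Ioc_subset_of_mem_nhds (hψ.open_J.mem_nhds hmin) (exists_lt _)
    obtain ⟨r, hr, hrJ⟩ := exists_Ico_subset_of_mem_nhds (hψ.open_J.mem_nhds hmax) (exists_gt _)
    refine ⟨l, r, ⟨hl.trans_le (min_le_left _ _), (le_max_left _ _).trans_lt hr⟩,
      ⟨hl.trans_le (min_le_right _ _), (le_max_right _ _).trans_lt hr⟩, fun s hs => ?_⟩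
    rcases le_total s (min 0 t) with h1 | h1
    · exact hlJ ⟨hs.1, h1⟩
    · rcases le_total s (max 0 t) with h2 | h2
      · exact hψ.interval_J.out hmin hmax ⟨h1, h2⟩
      · exact hrJ ⟨h2, hs.2⟩
  have hX1 : ContMDiff (𝓡 3) (𝓡 3).tangent 1 (fun q => (⟨q, X q⟩ : TangentBundle (𝓡 3) M)) :=
    (contMDiffOn_univ.1 hX).of_le (by exact_mod_cast le_top)
  have h1 := isMIntegralCurveOn_Ioo_eqOn_of_contMDiff_boundaryless htab hX1
    ((hψ.integral p hp).mono hab) ((hψ.integral p' hp').mono hab) heq h0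
  simpa only [hψ.initial p hp, hψ.initial p' hp'] using h1

/-! ### The two implications -/

namespace ContactStructure.IsReebPair

variable [IsManifold (𝓡 3) ∞ M] {L : ContactStructure M} {α : OneForm M} {X₀ : VField M}
  (h : L.IsReebPair α X₀)
include h

/-- The pull back of the metric on horizontal vectors is constant in time, and its derivative at
time `0` is the Lie derivative. -/
theorem lieAt_metric_of_isInfinitesimalIsometry (hI : L.IsInfinitesimalIsometry X₀) {q : M}
    (v w : L.H q) : lieAt X₀ h.metric q v w = 0 := by
  obtain ⟨J, U, ψ, hψ, hq⟩ := exists_isLocalFlow h.smooth_field q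
  have h1 := hψ.hasDerivAt_pullback h.smooth_field hψ.zero_mem hq (h.differentiableAt_metric _)
    (v : TangentSpace (𝓡 3) q) w
  rw [hψ.pullback_zero hq (lieAt X₀ h.metric)] at h1
  refine h1.unique ((hasDerivAt_const (0 : ℝ) (L.g q v w)).congr_of_eventuallyEq ?_)
  filter_upwards [hψ.open_J.mem_nhds hψ.zero_mem] with s hs
  obtain ⟨hH, hg⟩ := (hI J U ψ hψ s hs).2 q hq
  rw [← hg v w, ← h.metric_coe]

/-- Invariance of the nondegenerate extended metric makes the differentials injective and preserves
`g`; invariance of `α ⊗ α` preserves `H`. -/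
theorem isInfinitesimalIsometry [T2Space M]
    (h0 : ∀ (q : M) (v w : L.H q), lieAt X₀ h.metric q v w = 0) :
    L.IsInfinitesimalIsometry X₀ := by
  intro J U ψ hψ t ht
  have hm : ∀ p ∈ U, ∀ v w : TangentSpace (𝓡 3) p, h.metric (ψ t p)
      (mfderiv (𝓡 3) (𝓡 3) (ψ t) p v) (mfderiv (𝓡 3) (𝓡 3) (ψ t) p w) = h.metric p v w :=
    fun p hp => hψ.pullback_eq h.smooth_field h.differentiableAt_metric
      (fun q => h.lieAt_metric_eq_zero (h0 q)) ht hp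
  have ha : ∀ p ∈ U, ∀ v w : TangentSpace (𝓡 3) p, α.square (ψ t p)
      (mfderiv (𝓡 3) (𝓡 3) (ψ t) p v) (mfderiv (𝓡 3) (𝓡 3) (ψ t) p w) = α.square p v w :=
    fun p hp => hψ.pullback_eq h.smooth_field h.differentiableAt_square h.lieAt_square ht hp
  refine ⟨exists_partialDiffeomorph hψ.open_U
    (fun p hp => (hψ.contMDiffAt_right ht hp).contMDiffWithinAt) (hψ.injOn h.smooth_field ht)
    fun p hp => ?_, fun p hp => ?_⟩
  · refine (injective_iff_map_eq_zero _).2 fun v hv => h.metric_nondegenerate fun w => ?_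
    rw [← hm p hp v w, hv, map_zero, LinearMap.zero_apply]
  · have hH : ∀ v ∈ L.H p, mfderiv (𝓡 3) (𝓡 3) (ψ t) p v ∈ L.H (ψ t p) := by
      intro v hv
      -- On the diagonal `α ⊗ α` is the square of `α`, so its invariance controls the kernel; using
      -- the square lets one pull back lemma serve both tensors.
      have h1 := ha p hp v v
      rw [OneForm.square_apply, OneForm.square_apply, (h.mem_iff p v).1 hv, mul_zero] at h1
      exact (h.mem_iff _ _).2 (mul_self_eq_zero.1 h1)
    refine ⟨hH, fun v w => ?_⟩
    rw [← h.metric_coe, ← h.metric_coe]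
    exact hm p hp v w

end ContactStructure.IsReebPair

end SubLorentz

end

theorem mainTheorem3 {M : Type*} [TopologicalSpace M] [T2Space M]
    [ChartedSpace SubLorentz.E3 M] [IsManifold (𝓡 3) ∞ M]
    (L : SubLorentz.ContactStructure M) (o : SubLorentz.TSOrientation L)
    (X₀ : SubLorentz.VField M) (hX₀ : o.IsReebField X₀) :
    L.IsInfinitesimalIsometry X₀ ↔ ∀ q : M, L.hTilde X₀ q = 0 := by
  obtain ⟨hX, α, ⟨hα, hker, -⟩, h1, hd⟩ := hX₀
  have h : L.IsReebPair α X₀ := ⟨hα, hX, hker, h1, hd⟩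
  exact ⟨fun hI q => (h.hTilde_eq_zero_iff q).2 fun v w =>
    h.lieAt_metric_of_isInfinitesimalIsometry hI v w,
    fun h0 => h.isInfinitesimalIsometry fun q => (h.hTilde_eq_zero_iff q).1 (h0 q)⟩
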